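/- Let $d\ge 2$ and write $\widehat f(\xi)=\int_{\mathbb R^d}e^{-ix\cdot\xi}f(x)\,dx$ (extended to $L^2(\mathbb R^d)$ by Plancherel). For $\alpha>2$ and $t\in\mathbb R$ let $e^{it(-\Delta)^{\alpha/2}}$ be the Fourier multiplier operator on $L^2(\mathbb R^d)$ with symbol $e^{it|\xi|^\alpha}$. Let $\rho:\mathbb R\to\mathbb R$ be smooth, supported in $[1/2,4]$, with $\sum_{k\in\mathbb Z}\rho(x/2^k)=1$ for all $x>0$, and for $k\in\mathbb Z$ define $P_k$ by $\widehat{P_kf}(\xi)=\rho(|\xi|/2^k)\widehat f(\xi)$. Put $\|F\|_{L^q_tL^r_x}=\big\|\,\|F(t,\cdot)\|_{L^r(\mathbb R^d)}\big\|_{L^q(\mathbb R)}$ and $\beta(\alpha,q,r)=\frac d2-\frac dr-\frac\alpha q$ (with $1/\infty=0$). Let $2<q\le\infty$ and $2\le r<\infty$ satisfy $\frac2q+\frac dr<\frac d2$. Then there is $\epsilon=\epsilon(d,q,r)>0$ such that for every $\alpha>2$ and every $\rho$ as above there is a constant $C>0$ (depending on $d,q,r,\alpha,\rho$) such that for all integers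 $M\le N$ and all $f,g\in L^2(\mathbb R^d)$, $$\big\|e^{it(-\Delta)^{\alpha/2}}P_Nf\;\cdot\;e^{it(-\Delta)^{\alpha/2}}P_Mg\big\|_{L^{q/2}_tL^{r/2}_x}\le C\,2^{(M+N)\beta(\alpha,q,r)}\,\big(2^{M-N}\big)^{\epsilon}\,\|f\|_{L^2}\|g\|_{L^2}.$$ -/

import Mathlib

open MeasureTheory FourierTransform
open scoped ENNReal ContDiff

noncomputable section

/-- The space `L²(ℝᵈ; ℂ)`, with `ℝᵈ` carrying the Euclidean norm and Lebesgue measure. -/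
abbrev L2Space (d : ℕ) : Type :=
  Lp ℂ 2 (volume : Measure (EuclideanSpace ℝ (Fin d)))

lemma memLp_symbol_mul {d : ℕ} (m : EuclideanSpace ℝ (Fin d) → ℂ) (hm : Measurable m)
    (hb : ∃ K : ℝ, ∀ ξ, ‖m ξ‖ ≤ K) (g : L2Space d) :
    MemLp (fun ξ => m ((2 * Real.pi) • ξ) * g ξ) 2 volume := by
  obtain ⟨K, hK⟩ := hb
  refine MemLp.of_le_mul (c := K) (Lp.memLp g) ?_ ?_
  · exact ((hm.comp (measurable_const_smul (2 * Real.pi))).aestronglyMeasurable).mul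
      (Lp.aestronglyMeasurable g)
  · refine Filter.Eventually.of_forall fun ξ => ?_
    rw [norm_mul]
    exact mul_le_mul_of_nonneg_right (hK _) (norm_nonneg _)

/-- The Fourier multiplier on `L²(ℝᵈ)` with bounded measurable symbol `m`: the operator
`f ↦ m(D) f` with `(m(D) f)^(ξ) = m(ξ) f^(ξ)`, where `f^(ξ) = ∫ e^{-i x·ξ} f(x) dx`.
Mathlib's (Plancherel) transform `𝓕` uses the kernel `e^{-2πi x·ξ}`, so that
`f^(2π ξ) = 𝓕 f ξ`; hence the symbol is evaluated at `2π ξ`. -/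
def fourierMultiplier {d : ℕ} (m : EuclideanSpace ℝ (Fin d) → ℂ) (hm : Measurable m)
    (hb : ∃ K : ℝ, ∀ ξ, ‖m ξ‖ ≤ K) (f : L2Space d) : L2Space d :=
  𝓕⁻ ((memLp_symbol_mul m hm hb (𝓕 f)).toLp _)

/-- A smooth function `ρ` supported in `[1/2, 4]` with `∑_{k ∈ ℤ} ρ(x / 2ᵏ) = 1` for `x > 0`. -/
structure IsDyadicCutoff (ρ : ℝ → ℝ) : Prop where
  smooth : ContDiff ℝ ∞ ρ
  support_subset : Function.support ρ ⊆ Set.Icc (1 / 2) 4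
  hasSum_one : ∀ x : ℝ, 0 < x → HasSum (fun k : ℤ => ρ (x / 2 ^ k)) 1

lemma IsDyadicCutoff.exists_bound {ρ : ℝ → ℝ} (hρ : IsDyadicCutoff ρ) :
    ∃ K : ℝ, ∀ x, ‖ρ x‖ ≤ K :=
  (HasCompactSupport.of_support_subset_isCompact isCompact_Icc
    hρ.support_subset).exists_bound_of_continuous hρ.smooth.continuous

/-- The symbol `ξ ↦ ρ(|ξ| / 2ᵏ)`. -/
def dyadicSymbol (d : ℕ) (ρ : ℝ → ℝ) (k : ℤ) (ξ : EuclideanSpace ℝ (Fin d)) : ℂ :=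
  (ρ (‖ξ‖ / 2 ^ k) : ℂ)

lemma measurable_dyadicSymbol (d : ℕ) {ρ : ℝ → ℝ} (hρ : IsDyadicCutoff ρ) (k : ℤ) :
    Measurable (dyadicSymbol d ρ k) :=
  Complex.measurable_ofReal.comp
    (hρ.smooth.continuous.measurable.comp (measurable_norm.div_const _))

lemma bounded_dyadicSymbol (d : ℕ) {ρ : ℝ → ℝ} (hρ : IsDyadicCutoff ρ) (k : ℤ) :
    ∃ K : ℝ, ∀ ξ, ‖dyadicSymbol d ρ k ξ‖ ≤ K := by
  obtain ⟨K, hK⟩ := hρ.exists_bound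
  refine ⟨K, fun ξ => ?_⟩
  rw [dyadicSymbol, Complex.norm_real]
  exact hK _

/-- The Littlewood–Paley operator `P_k`: `(P_k f)^(ξ) = ρ(|ξ| / 2ᵏ) f^(ξ)`. -/
def dyadicProj {d : ℕ} {ρ : ℝ → ℝ} (hρ : IsDyadicCutoff ρ) (k : ℤ) (f : L2Space d) :
    L2Space d :=
  fourierMultiplier (dyadicSymbol d ρ k) (measurable_dyadicSymbol d hρ k)
    (bounded_dyadicSymbol d hρ k) f

/-- The symbol `ξ ↦ e^{i t |ξ|^α}`. -/
def propagatorSymbol (d : ℕ) (α t : ℝ) (ξ : EuclideanSpace ℝ (Fin d)) : ℂ :=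
  Complex.exp (((t * ‖ξ‖ ^ α : ℝ) : ℂ) * Complex.I)

lemma measurable_propagatorSymbol (d : ℕ) (α t : ℝ) :
    Measurable (propagatorSymbol d α t) :=
  Complex.measurable_exp.comp ((Complex.measurable_ofReal.comp
    ((measurable_norm.pow_const α).const_mul t)).mul_const _)

lemma bounded_propagatorSymbol (d : ℕ) (α t : ℝ) :
    ∃ K : ℝ, ∀ ξ, ‖propagatorSymbol d α t ξ‖ ≤ K :=
  ⟨1, fun _ => (Complex.norm_exp_ofReal_mul_I _).le⟩

/-- The free propagator `e^{it(-Δ)^{α/2}}` on `L²(ℝᵈ)`: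
`(e^{it(-Δ)^{α/2}} f)^(ξ) = e^{i t |ξ|^α} f^(ξ)`. -/
def propagator {d : ℕ} (α t : ℝ) (f : L2Space d) : L2Space d :=
  fourierMultiplier (propagatorSymbol d α t) (measurable_propagatorSymbol d α t)
    (bounded_propagatorSymbol d α t) f

/-- The mixed norm `‖F‖_{L^q_t L^r_x} = ‖ t ↦ ‖F(t, ·)‖_{L^r(ℝᵈ)} ‖_{L^q(ℝ)}`, in `[0, ∞]`. -/
def mixedNorm {d : ℕ} (q r : ℝ≥0∞) (F : ℝ → EuclideanSpace ℝ (Fin d) → ℂ) : ℝ≥0∞ :=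
  eLpNorm (fun t : ℝ => eLpNorm (F t) r volume) q volume

/-- The scaling exponent `β(α, q, r) = d/2 - d/r - α/q`, where `1/∞ = 0`. -/
def scalingExponent (d : ℕ) (α : ℝ) (q r : ℝ≥0∞) : ℝ :=
  (d : ℝ) / 2 - d * (r⁻¹).toReal - α * (q⁻¹).toReal

end

/-!
The bilinear gain comes from Hölder's inequality with two different exponents. Since
`2/q + d/r < d/2` is an open condition, the linear Strichartz estimate
`exists_eLpNorm_propagator_dyadicProj_le` holds with `1/r + δ` and with `1/r - δ` in place of `1/r`,
for some `δ > 0`. Estimating the high-frequency factor (frequency `2^N`) in the former space and the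
low-frequency factor (frequency `2^M`) in the latter, the powers of `2` combine to
`2^{(M+N)β} 2^{(M-N)dδ}`, so that `ε = d δ`.

The linear estimate is non-endpoint, which allows an elementary `TT*` argument. By scaling
(`propagator_dyadicProj_ae_eq`) the frequency is `1`.

* Dispersive decay `(1 + |t|)^{-d/2}` of the kernel (`exists_norm_fourierInv_propagator_le`). The
  phase `|ξ|^α` on the support of the cutoff is extended to a smooth phase with strongly monotone
  gradient (`exists_global_phase`). For such a phase the square of the oscillatory integral is an
  integral over lags `h` of integrals with phase `t (Φ(η + h) - Φ(η))`, whose derivative in the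
  direction of `h` is at least `c |t| |h|`; integrations by parts in that direction
  (`exists_norm_integral_exp_mul_le`) give decay in `|t| |h|`, and integrating in `h` gives
  `|t|^{-d}` (`exists_norm_oscillatory_integral_le`).
* Interpolation with Plancherel (`lintegral_rpow_le_of_L1_Linfty_of_L2`), by truncating the function
  at a height adapted to the level set being estimated. This gives the decay
  `(1 + |t|)^{-(d/2)(1 - 2/r)}` from `L^{r'}` to `L^r`, in the form of a bound on a sesquilinear
  form (`norm_integral_mul_fourier_conj_fourier_le`).
* `TT*` along integer times (`exists_sum_freqEvol_le`). The resulting double sum has a kernel in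
  `ℓ^{q/2}(ℤ)`, because the scaling condition is strict, and Young's inequality
  (`sum_sum_mul_le_of_summable`) applies.
* The integral over `t ∈ ℝ` is an average over shifts of sums along integer times, and shifts do not
  change the `L²` norm of the data (`exists_eLpNorm_eLpNorm_freqEvol_le`). For `q = ∞` the sum with
  a large finite exponent bounds each of its terms.
-/

/-! ### The Fourier integral on `L¹ ∩ L²` -/

section FourierAux

variable {E : Type*} [NormedAddCommGroup E] [InnerProductSpace ℝ E] [FiniteDimensional ℝ E]
  [MeasurableSpace E] [BorelSpace E]

lemma integral_fourier_mul_eq {f g : E → ℂ} (hf : Integrable f) (hg : Integrable g) :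
    ∫ ξ, 𝓕 f ξ * g ξ = ∫ x, f x * 𝓕 g x := by
  have := VectorFourier.integral_fourierIntegral_smul_eq_flip (L := innerₗ E)
    Real.continuous_fourierChar continuous_inner hf hg
  rw [flip_innerₗ] at this
  exact this

lemma integral_fourierInv_mul_eq {f g : E → ℂ} (hf : Integrable f) (hg : Integrable g) :
    ∫ ξ, 𝓕⁻ f ξ * g ξ = ∫ x, f x * 𝓕⁻ g x := by
  rw [Real.fourierInv_eq_fourier_comp_neg f, integral_fourier_mul_eq hf.comp_neg hg,
    ← integral_neg_eq_self]
  simp [Real.fourierInv_eq_fourier_neg]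

lemma conj_fourier (f : E → ℂ) (ξ : E) :
    (starRingEnd ℂ) (𝓕 f ξ) = 𝓕⁻ (fun x => (starRingEnd ℂ) (f x)) ξ := by
  rw [Real.fourier_eq', Real.fourierInv_eq', ← integral_conj]
  congr 1
  ext x
  rw [smul_eq_mul, map_mul, ← Complex.exp_conj, map_mul, Complex.conj_ofReal, Complex.conj_I]
  congr 2
  push_cast
  ring

/-- The adjoint of the inverse Fourier integral is the Fourier integral, on `L¹` functions. -/
lemma integral_fourierInv_mul_conj {f g : E → ℂ} (hf : Integrable f) (hg : Integrable g) :
    ∫ x, 𝓕⁻ f x * (starRingEnd ℂ) (g x) = ∫ ξ, f ξ * (starRingEnd ℂ) (𝓕 g ξ) := by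
  have hg' : Integrable (fun x => (starRingEnd ℂ) (g x)) := by
    exact (Complex.conjLIE.integrable_comp_iff).2 hg
  rw [integral_fourierInv_mul_eq hf hg']
  simp_rw [conj_fourier]

lemma continuous_fourierInv {f : E → ℂ} (hf : Integrable f) : Continuous (𝓕⁻ f) := by
  have := VectorFourier.fourierIntegral_continuous (L := innerₗ E)
    Real.continuous_fourierChar continuous_inner hf
  have h2 : 𝓕⁻ f = fun x => 𝓕 f (-x) := by
    ext x
    exact Real.fourierInv_eq_fourier_neg f x
  rw [h2]
  exact Continuous.comp (g := 𝓕 f) this continuous_neg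

lemma continuous_fourier {f : E → ℂ} (hf : Integrable f) : Continuous (𝓕 f) :=
  VectorFourier.fourierIntegral_continuous (L := innerₗ E)
    Real.continuous_fourierChar continuous_inner hf

lemma norm_fourier_le (f : E → ℂ) (x : E) : ‖𝓕 f x‖ ≤ ∫ ξ, ‖f ξ‖ := by
  rw [Real.fourier_eq']
  refine (norm_integral_le_integral_norm _).trans (le_of_eq ?_)
  congr 1
  ext ξ
  rw [norm_smul, Complex.norm_exp_ofReal_mul_I, one_mul]

/-- On `L¹ ∩ L²` the Plancherel inverse Fourier transform is given by the Fourier integral: both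
sides have the same integral against every test function. -/
lemma fourierInv_toLp_ae_eq {h : E → ℂ} (h1 : Integrable h) (h2 : MemLp h 2) :
    ((𝓕⁻ (h2.toLp h) : Lp ℂ 2 (volume : Measure E)) : E → ℂ) =ᵐ[volume] 𝓕⁻ h := by
  refine ae_eq_of_integral_contDiff_smul_eq ?_ ?_ ?_
  · exact (Lp.memLp _).locallyIntegrable (by norm_num)
  · exact (continuous_fourierInv h1).locallyIntegrable
  · intro g hg hgc
    have hgc' : HasCompactSupport (fun x => (g x : ℂ)) :=
      hgc.comp_left (g := fun r : ℝ => (r : ℂ)) (by simp)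
    have hg' : ContDiff ℝ ∞ (fun x => (g x : ℂ)) := Complex.ofRealCLM.contDiff.comp hg
    let G : SchwartzMap E ℂ := hgc'.toSchwartzMap hg'
    have hG : ∀ x, G x = g x := fun x => rfl
    have key := congrArg (fun T => T G) (Lp.fourierInv_toTemperedDistribution_eq (h2.toLp h))
    simp only [TemperedDistribution.fourierInv_apply, Lp.toTemperedDistribution_apply] at key
    have hGi : Integrable (fun x => G x) := G.integrable
    have e1 : ∫ x, G x * ((𝓕⁻ (h2.toLp h) : Lp ℂ 2 (volume : Measure E)) : E → ℂ) x =
        ∫ x, (𝓕⁻ (fun x => G x)) x * h x := by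
      refine Eq.trans key.symm (integral_congr_ae ?_)
      filter_upwards [h2.coeFn_toLp] with x hx
      rw [hx, smul_eq_mul, SchwartzMap.fourierInv_coe]
    have e2 := e1.trans (integral_fourierInv_mul_eq hGi h1)
    simp only [hG, ← Complex.real_smul] at e2
    exact e2

lemma eLpNorm_fourierInv {h : E → ℂ} (h1 : Integrable h) (h2 : MemLp h 2) :
    eLpNorm (𝓕⁻ h) 2 volume = eLpNorm h 2 volume := by
  rw [← eLpNorm_congr_ae (fourierInv_toLp_ae_eq h1 h2)]
  have e1 : ‖(𝓕⁻ (h2.toLp h) : Lp ℂ 2 (volume : Measure E))‖ₑ = ‖h2.toLp h‖ₑ := by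
    rw [enorm_eq_iff_norm_eq]
    conv_rhs =>
      rw [← FourierTransform.fourier_fourierInv_eq (F := Lp ℂ 2 (volume : Measure E)) (h2.toLp h)]
    rw [Lp.norm_fourier_eq]
  rw [Lp.enorm_def, Lp.enorm_def] at e1
  rw [e1, eLpNorm_congr_ae h2.coeFn_toLp]

lemma eLpNorm_fourier {h : E → ℂ} (h1 : Integrable h) (h2 : MemLp h 2) :
    eLpNorm (𝓕 h) 2 volume = eLpNorm h 2 volume := by
  have e : 𝓕 h = (𝓕⁻ h) ∘ (fun x => -x) := by
    ext x
    simp [Real.fourierInv_eq_fourier_neg]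
  rw [e, eLpNorm_comp_measurePreserving (continuous_fourierInv h1).aestronglyMeasurable
    (Measure.measurePreserving_neg _), eLpNorm_fourierInv h1 h2]

end FourierAux

/-! ### Interpolation between `L¹ → L^∞` and `L² → L²` -/

section Interpolation

lemma lintegral_Ioc_rpow {S a : ℝ} (hS : 0 ≤ S) (ha : -1 < a) :
    ∫⁻ s in Set.Ioc 0 S, ENNReal.ofReal (s ^ a) = ENNReal.ofReal (S ^ (a + 1) / (a + 1)) := by
  rw [← ofReal_integral_eq_lintegral_ofReal]
  · rw [← intervalIntegral.integral_of_le hS, integral_rpow (Or.inl ha),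
      Real.zero_rpow (by linarith), sub_zero]
  · exact (intervalIntegrable_iff_integrableOn_Ioc_of_le hS).1
      (intervalIntegral.intervalIntegrable_rpow' ha)
  · filter_upwards [ae_restrict_mem measurableSet_Ioc] with s hs
    exact Real.rpow_nonneg hs.1.le _

variable {X Y : Type*} [MeasurableSpace X] [MeasurableSpace Y] {μ : Measure X} {ν : Measure Y}

/-- The `L¹` norm of the part of `f` above height `l` is controlled by the `L^p` norm of `f`,
since `|f| ≤ l ^ (1 - p) |f| ^ p` there. -/
lemma lintegral_indicator_lt_norm_le (f : X → ℂ) (l p : ℝ) (hl : 0 < l) (hp : 1 ≤ p) :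
    ∫⁻ x, ‖({x | l < ‖f x‖}.indicator f) x‖ₑ ∂μ ≤
      ENNReal.ofReal (l ^ (1 - p)) * ∫⁻ x, ENNReal.ofReal (‖f x‖ ^ p) ∂μ := by
  rw [← lintegral_const_mul' _ _ ENNReal.ofReal_ne_top]
  refine lintegral_mono fun x => ?_
  by_cases hx : l < ‖f x‖
  · rw [Set.indicator_of_mem (by exact hx), ← ENNReal.ofReal_mul (by positivity),
      ← ofReal_norm]
    refine ENNReal.ofReal_le_ofReal ?_
    have h0 : 0 < ‖f x‖ := hl.trans hx
    calc ‖f x‖ = ‖f x‖ ^ (1 - p) * ‖f x‖ ^ p := by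
          rw [← Real.rpow_add h0]; simp
      _ ≤ l ^ (1 - p) * ‖f x‖ ^ p := by
          gcongr ?_ * _
          exact Real.rpow_le_rpow_of_nonpos hl hx.le (by linarith)
  · rw [Set.indicator_of_notMem (by exact hx)]
    simp

/-- Interpolation between an `L¹ → L^∞` bound and an `L²` bound for an additive operator on
`L¹ ∩ L²`, with the sharp dependence on the `L¹ → L^∞` bound. The function is truncated at a height
depending on the level `s` for which the distribution function of `T f` is estimated; the height is
chosen so that the image of the upper part is at most `s / 2`. -/
theorem lintegral_rpow_le_of_L1_Linfty_of_L2 [SFinite μ] (T : (X → ℂ) → Y → ℂ) {A : ℝ≥0∞} {B r : ℝ}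
    (hB : 0 < B) (hr : 2 < r)
    (hadd : ∀ f g : X → ℂ, Measurable f → Integrable f μ → MemLp f 2 μ →
      Measurable g → Integrable g μ → MemLp g 2 μ → ∀ y, T (f + g) y = T f y + T g y)
    (hmeas : ∀ f : X → ℂ, Measurable f → Integrable f μ → MemLp f 2 μ → AEMeasurable (T f) ν)
    (hinf : ∀ f : X → ℂ, Measurable f → Integrable f μ → MemLp f 2 μ →
      ∀ y, ‖T f y‖ₑ ≤ ENNReal.ofReal B * ∫⁻ x, ‖f x‖ₑ ∂μ)
    (htwo : ∀ f : X → ℂ, Measurable f → Integrable f μ → MemLp f 2 μ →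
      ∫⁻ y, ‖T f y‖ₑ ^ 2 ∂ν ≤ A * ∫⁻ x, ‖f x‖ₑ ^ 2 ∂μ)
    {f : X → ℂ} (hf : Measurable f) (hf1 : Integrable f μ) (hf2 : MemLp f 2 μ) :
    ∫⁻ y, ENNReal.ofReal (‖T f y‖ ^ r) ∂ν ≤
      ENNReal.ofReal (4 * r / (r - 2) * (2 * B) ^ (r - 2)) * A *
        (∫⁻ x, ENNReal.ofReal (‖f x‖ ^ (r / (r - 1))) ∂μ) ^ (r - 1) := by
  set p : ℝ := r / (r - 1) with hp
  have hr1 : 0 < r - 1 := by linarith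
  have hp1 : 1 < p := by rw [hp, lt_div_iff₀ hr1]; linarith
  have hp2 : p < 2 := by rw [hp, div_lt_iff₀ hr1]; linarith
  have hpr : (1 - p) * (r - 1) = -1 := by rw [hp]; field_simp; ring
  set N := ∫⁻ x, ENNReal.ofReal (‖f x‖ ^ p) ∂μ with hN
  have hNfin : N ≠ ⊤ := by
    have h2 : Integrable (fun x => ‖f x‖ ^ 2) μ := hf2.integrable_norm_pow (by norm_num)
    have hfin : ∫⁻ x, ENNReal.ofReal (‖f x‖ + ‖f x‖ ^ 2) ∂μ < ⊤ :=
      (hf1.norm.add h2).lintegral_lt_top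
    refine ne_top_of_le_ne_top hfin.ne (lintegral_mono fun x => ENNReal.ofReal_le_ofReal ?_)
    rcases le_total ‖f x‖ 1 with h | h
    · have := Real.rpow_le_rpow_of_exponent_ge' (norm_nonneg (f x)) h zero_le_one hp1.le
      rw [Real.rpow_one] at this
      nlinarith [sq_nonneg ‖f x‖]
    · have := Real.rpow_le_rpow_of_exponent_le h hp2.le
      rw [Real.rpow_two] at this
      linarith [norm_nonneg (f x)]
  by_cases hN0 : N = 0
  · have hz : f =ᵐ[μ] 0 := by
      rw [hN, lintegral_eq_zero_iff (by fun_prop)] at hN0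
      filter_upwards [hN0] with x hx
      by_contra hne
      have : 0 < ‖f x‖ := norm_pos_iff.2 hne
      have h3 : 0 < ‖f x‖ ^ p := by positivity
      simp only [Pi.zero_apply, ENNReal.ofReal_eq_zero] at hx
      linarith
    have hz' : ∀ y, T f y = 0 := fun y => by
      have h1 : ∫⁻ x, ‖f x‖ₑ ∂μ = 0 := by
        rw [lintegral_eq_zero_iff (by fun_prop)]
        filter_upwards [hz] with x hx
        simp [hx]
      have := hinf f hf hf1 hf2 y
      simpa [h1] using this
    simp [hz', Real.zero_rpow (by linarith : r ≠ 0)]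
  set n := N.toReal with hn
  have hn0 : 0 < n := ENNReal.toReal_pos hN0 hNfin
  have hNn : N = ENNReal.ofReal n := (ENNReal.ofReal_toReal hNfin).symm
  set D := 2 * B * n with hD
  have hD0 : 0 < D := by positivity
  -- truncation height at level `s`: it makes `B ‖hi s‖₁ ≤ B (l s) ^ (1 - p) n` equal to `s / 2`
  let l : ℝ → ℝ := fun s => (D / s) ^ (r - 1)
  have hl : ∀ s, 0 < s → 0 < l s := fun s hs => by positivity
  let lo : ℝ → X → ℂ := fun s => {x | ‖f x‖ ≤ l s}.indicator f
  let hi : ℝ → X → ℂ := fun s => {x | l s < ‖f x‖}.indicator f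
  have hsplit : ∀ s, f = lo s + hi s := fun s => by
    ext x
    by_cases h : ‖f x‖ ≤ l s
    · simp [lo, hi, h]
    · simp [lo, hi, h, not_le.1 h]
  have hmlo : ∀ s, MeasurableSet {x | ‖f x‖ ≤ l s} := fun s =>
    measurableSet_le hf.norm measurable_const
  have hmhi : ∀ s, MeasurableSet {x | l s < ‖f x‖} := fun s =>
    measurableSet_lt measurable_const hf.norm
  -- the image of the upper part stays below `s / 2`
  have hhi : ∀ s, 0 < s → ∀ y, ‖T (hi s) y‖ₑ ≤ ENNReal.ofReal (s / 2) := by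
    intro s hs y
    refine (hinf _ (hf.indicator (hmhi s)) (hf1.indicator (hmhi s)) (hf2.indicator (hmhi s))
      y).trans ?_
    refine (mul_le_mul_right (lintegral_indicator_lt_norm_le f (l s) p (hl s hs) hp1.le) _).trans
      (le_of_eq ?_)
    rw [← hN, hNn, ← ENNReal.ofReal_mul (by positivity), ← ENNReal.ofReal_mul (by positivity)]
    congr 1
    have : l s ^ (1 - p) = s / D := by
      rw [show l s = (D / s) ^ (r - 1) from rfl, ← Real.rpow_mul (by positivity),
        mul_comm (r - 1), hpr, Real.rpow_neg_one, inv_div]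
    rw [this, hD]
    field_simp
  -- hence where `|T f| > s` the lower part contributes at least `s / 2`: apply Chebyshev in `L²`
  have hdist : ∀ s, 0 < s → ν {y | s < ‖T f y‖} ≤
      ENNReal.ofReal (4 * s ^ (-2 : ℝ)) * (A * ∫⁻ x, ‖lo s x‖ₑ ^ 2 ∂μ) := by
    intro s hs
    have hsub : {y | s < ‖T f y‖} ⊆ {y | ENNReal.ofReal (s / 2) ^ 2 ≤ ‖T (lo s) y‖ₑ ^ 2} := by
      intro y hy
      have e : T f y = T (lo s) y + T (hi s) y := by
        conv_lhs => rw [hsplit s]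
        exact hadd _ _ (hf.indicator (hmlo s)) (hf1.indicator (hmlo s)) (hf2.indicator (hmlo s))
          (hf.indicator (hmhi s)) (hf1.indicator (hmhi s)) (hf2.indicator (hmhi s)) y
      have h1 := hhi s hs y
      rw [← ofReal_norm, ENNReal.ofReal_le_ofReal_iff (by positivity)] at h1
      have h2 : s < ‖T f y‖ := hy
      rw [e] at h2
      have h3 := norm_add_le (T (lo s) y) (T (hi s) y)
      have h4 : s / 2 ≤ ‖T (lo s) y‖ := by linarith
      have h5 : ENNReal.ofReal (s / 2) ≤ ‖T (lo s) y‖ₑ := by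
        rw [← ofReal_norm]; exact ENNReal.ofReal_le_ofReal h4
      exact pow_le_pow_left₀ (zero_le) h5 2
    have hcheb := mul_meas_ge_le_lintegral₀ (μ := ν) (f := fun y => ‖T (lo s) y‖ₑ ^ 2)
      ((hmeas _ (hf.indicator (hmlo s)) (hf1.indicator (hmlo s))
        (hf2.indicator (hmlo s))).enorm.pow_const 2) (ENNReal.ofReal (s / 2) ^ 2)
    have hc0 : ENNReal.ofReal (4 * s ^ (-2 : ℝ)) * ENNReal.ofReal (s / 2) ^ 2 = 1 := by
      rw [← ENNReal.ofReal_pow (by positivity), ← ENNReal.ofReal_mul (by positivity),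
        Real.rpow_neg hs.le, Real.rpow_two]
      rw [show 4 * (s ^ 2)⁻¹ * (s / 2) ^ 2 = 1 by field_simp; norm_num, ENNReal.ofReal_one]
    calc ν {y | s < ‖T f y‖} ≤ ν {y | ENNReal.ofReal (s / 2) ^ 2 ≤ ‖T (lo s) y‖ₑ ^ 2} :=
          measure_mono hsub
      _ = ENNReal.ofReal (4 * s ^ (-2 : ℝ)) * (ENNReal.ofReal (s / 2) ^ 2 *
            ν {y | ENNReal.ofReal (s / 2) ^ 2 ≤ ‖T (lo s) y‖ₑ ^ 2}) := by
          rw [← mul_assoc, hc0, one_mul]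
      _ ≤ _ := by
          refine mul_le_mul_right ?_ _
          exact hcheb.trans (htwo _ (hf.indicator (hmlo s)) (hf1.indicator (hmlo s))
            (hf2.indicator (hmlo s)))
  -- `lo s x` vanishes for `s` beyond the level `S` at which the truncation height is `|f x|`
  have hinner : ∀ x, ∫⁻ s in Set.Ioi (0 : ℝ), ‖lo s x‖ₑ ^ 2 * ENNReal.ofReal (s ^ (r - 3)) ≤
      ENNReal.ofReal (D ^ (r - 2) / (r - 2)) * ENNReal.ofReal (‖f x‖ ^ p) := by
    intro x
    by_cases hx : f x = 0
    · have : ∀ s, lo s x = 0 := fun s => by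
        simp only [lo, Set.indicator_apply, hx, ite_self]
      simp [this]
    have hx0 : 0 < ‖f x‖ := norm_pos_iff.2 hx
    set S := D * ‖f x‖ ^ (-(r - 1)⁻¹) with hS
    have hS0 : 0 < S := by positivity
    have hptw : ∀ s ∈ Set.Ioi (0 : ℝ), ‖lo s x‖ₑ ^ 2 * ENNReal.ofReal (s ^ (r - 3)) ≤
        (Set.Ioc 0 S).indicator
          (fun s => ENNReal.ofReal (‖f x‖ ^ 2) * ENNReal.ofReal (s ^ (r - 3))) s := by
      intro s hs
      have hs : 0 < s := hs
      by_cases hxs : ‖f x‖ ≤ l s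
      · have hsS : s ≤ S := by
          have h1 : ‖f x‖ ^ (r - 1)⁻¹ ≤ D / s := by
            calc ‖f x‖ ^ (r - 1)⁻¹ ≤ (l s) ^ (r - 1)⁻¹ := by gcongr
              _ = D / s := Real.rpow_rpow_inv (by positivity) hr1.ne'
          rw [hS, Real.rpow_neg hx0.le]
          rw [le_div_iff₀ hs] at h1
          rw [← div_eq_mul_inv, le_div_iff₀ (by positivity)]
          linarith
        rw [Set.indicator_of_mem (show s ∈ Set.Ioc 0 S from ⟨hs, hsS⟩)]
        simp only [lo]
        rw [Set.indicator_of_mem (by exact hxs), ← ofReal_norm,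
          ENNReal.ofReal_pow (norm_nonneg _)]
      · have : lo s x = 0 := Set.indicator_of_notMem (by exact hxs) _
        simp [this]
    refine (setLIntegral_mono' measurableSet_Ioi hptw).trans ?_
    rw [lintegral_indicator measurableSet_Ioc, Measure.restrict_restrict measurableSet_Ioc,
      Set.inter_eq_self_of_subset_left Set.Ioc_subset_Ioi_self,
      lintegral_const_mul' _ _ ENNReal.ofReal_ne_top, lintegral_Ioc_rpow hS0.le (by linarith),
      ← ENNReal.ofReal_mul (by positivity), ← ENNReal.ofReal_mul (div_nonneg (by positivity)
      (by linarith))]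
    refine ENNReal.ofReal_le_ofReal (le_of_eq ?_)
    rw [show r - 3 + 1 = r - 2 by ring, hS, Real.mul_rpow hD0.le (by positivity),
      ← Real.rpow_mul hx0.le, show p = 2 + -(r - 1)⁻¹ * (r - 2) by rw [hp]; field_simp; ring,
      Real.rpow_add hx0, Real.rpow_two]
    ring
  have hlc : ∫⁻ y, ENNReal.ofReal (‖T f y‖ ^ r) ∂ν = ENNReal.ofReal r *
      ∫⁻ s in Set.Ioi 0, ν {y | s < ‖T f y‖} * ENNReal.ofReal (s ^ (r - 1)) :=
    lintegral_rpow_eq_lintegral_meas_lt_mul ν (Filter.Eventually.of_forall fun y => norm_nonneg _)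
      (hmeas f hf hf1 hf2).norm (by linarith)
  have hjm : Measurable (Function.uncurry fun (s : ℝ) (x : X) =>
      ‖lo s x‖ₑ ^ 2 * ENNReal.ofReal (s ^ (r - 3))) := by
    have hset : MeasurableSet {z : ℝ × X | ‖f z.2‖ ≤ l z.1} := by
      refine measurableSet_le (by fun_prop) ?_
      exact (measurable_const.div measurable_fst).pow_const _
    have : (fun z : ℝ × X => lo z.1 z.2) =
        {z : ℝ × X | ‖f z.2‖ ≤ l z.1}.indicator (fun z => f z.2) := by
      ext z
      simp only [lo, Set.indicator_apply, Set.mem_ofPred_eq]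
    have hlo : Measurable (fun z : ℝ × X => lo z.1 z.2) := by
      rw [this]; exact (hf.comp measurable_snd).indicator hset
    exact (hlo.enorm.pow_const 2).mul ((measurable_fst.pow_const _).ennreal_ofReal)
  calc ∫⁻ y, ENNReal.ofReal (‖T f y‖ ^ r) ∂ν
      = ENNReal.ofReal r *
        ∫⁻ s in Set.Ioi 0, ν {y | s < ‖T f y‖} * ENNReal.ofReal (s ^ (r - 1)) := hlc
    _ ≤ ENNReal.ofReal r * ∫⁻ s in Set.Ioi 0, (ENNReal.ofReal 4 * A) *
          ∫⁻ x, ‖lo s x‖ₑ ^ 2 * ENNReal.ofReal (s ^ (r - 3)) ∂μ := by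
        refine mul_le_mul_right ?_ _
        refine setLIntegral_mono' measurableSet_Ioi fun s hs => ?_
        have hs : 0 < s := hs
        refine (mul_le_mul_left (hdist s hs) _).trans (le_of_eq ?_)
        rw [lintegral_mul_const' _ _ ENNReal.ofReal_ne_top,
          show s ^ (r - 3) = s ^ (-2 : ℝ) * s ^ (r - 1) by rw [← Real.rpow_add hs]; ring_nf,
          ENNReal.ofReal_mul (by norm_num), ENNReal.ofReal_mul (by positivity)]
        ring
    _ = ENNReal.ofReal r * ((ENNReal.ofReal 4 * A) * ∫⁻ x, (∫⁻ s in Set.Ioi (0 : ℝ),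
          ‖lo s x‖ₑ ^ 2 * ENNReal.ofReal (s ^ (r - 3))) ∂μ) := by
        have hm : Measurable fun s => ∫⁻ x, ‖lo s x‖ₑ ^ 2 * ENNReal.ofReal (s ^ (r - 3)) ∂μ :=
          hjm.lintegral_prod_right'
        rw [lintegral_const_mul _ hm, lintegral_lintegral_swap]
        exact hjm.aemeasurable
    _ ≤ ENNReal.ofReal r * ((ENNReal.ofReal 4 * A) *
          ∫⁻ x, ENNReal.ofReal (D ^ (r - 2) / (r - 2)) * ENNReal.ofReal (‖f x‖ ^ p) ∂μ) := by
        exact mul_le_mul_right (mul_le_mul_right (lintegral_mono hinner) _) _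
    _ = _ := by
        rw [lintegral_const_mul' _ _ ENNReal.ofReal_ne_top, ← hN, hNn,
          ENNReal.ofReal_rpow_of_pos hn0]
        have e : 4 * r / (r - 2) * (2 * B) ^ (r - 2) * n ^ (r - 1) =
            r * 4 * (D ^ (r - 2) / (r - 2)) * n := by
          rw [hD, Real.mul_rpow (by positivity) hn0.le,
            show r - 1 = (r - 2) + 1 by ring, Real.rpow_add hn0, Real.rpow_one]
          have : r - 2 ≠ 0 := by linarith
          field_simp
        have h0 : (0 : ℝ) ≤ D ^ (r - 2) / (r - 2) := div_nonneg (by positivity) (by linarith)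
        have h1 : (0 : ℝ) ≤ 4 * r / (r - 2) * (2 * B) ^ (r - 2) :=
          mul_nonneg (div_nonneg (by linarith) (by linarith)) (by positivity)
        calc _ = ENNReal.ofReal (r * 4 * (D ^ (r - 2) / (r - 2)) * n) * A := by
              rw [ENNReal.ofReal_mul (by positivity), ENNReal.ofReal_mul (by positivity),
                ENNReal.ofReal_mul (by positivity)]
              ring
          _ = _ := by
              rw [← e, ENNReal.ofReal_mul h1]
              ring

end Interpolation

/-! ### Families with uniformly bounded directional derivatives -/

section DirectionalBounds

universe u v

variable {ι : Type v} {E : Type u} [NormedAddCommGroup E] [NormedSpace ℝ E]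

/-- A family of functions `a i`, each with its own direction `e i`, is `DirBdd e n` if the
derivatives `∂_{e i}^k (a i)`, `k ≤ n`, are bounded uniformly in `i`. -/
def DirBdd (e : ι → E) : ℕ → (ι → E → ℂ) → Prop
  | 0, a => ∃ C : ℝ, ∀ i x, ‖a i x‖ ≤ C
  | n + 1, a => (∃ C : ℝ, ∀ i x, ‖a i x‖ ≤ C) ∧ DirBdd e n (fun i x => fderiv ℝ (a i) x (e i))

variable {e : ι → E}

lemma DirBdd.bdd {n : ℕ} {a : ι → E → ℂ} (h : DirBdd e n a) : ∃ C : ℝ, ∀ i x, ‖a i x‖ ≤ C := by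
  cases n with
  | zero => exact h
  | succ n => exact h.1

lemma DirBdd.of_succ {n : ℕ} {a : ι → E → ℂ} (h : DirBdd e (n + 1) a) : DirBdd e n a := by
  induction n generalizing a with
  | zero => exact h.1
  | succ n ih => exact ⟨h.1, ih h.2⟩

lemma ContDiff.fderiv_apply_const {F : Type*} [NormedAddCommGroup F] [NormedSpace ℝ F] {a : E → F}
    (ha : ContDiff ℝ ∞ a) (w : E) : ContDiff ℝ ∞ (fun x => fderiv ℝ a x w) :=
  (ha.fderiv_right (m := ∞) (by simp)).clm_apply contDiff_const

lemma ContDiff.differentiable_of_infty {F : Type*} [NormedAddCommGroup F] [NormedSpace ℝ F]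
    {a : E → F} (ha : ContDiff ℝ ∞ a) : Differentiable ℝ a :=
  ha.differentiable (by simp)

lemma DirBdd.exists_norm_add_le {n : ℕ} {a b : ι → E → ℂ} (ha : DirBdd e n a)
    (hb : DirBdd e n b) : ∃ C : ℝ, ∀ i x, ‖a i x + b i x‖ ≤ C := by
  obtain ⟨C, hC⟩ := ha.bdd
  obtain ⟨C', hC'⟩ := hb.bdd
  exact ⟨C + C', fun i x => (norm_add_le _ _).trans (add_le_add (hC i x) (hC' i x))⟩

lemma DirBdd.exists_norm_mul_le {n : ℕ} {a b : ι → E → ℂ} (ha : DirBdd e n a)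
    (hb : DirBdd e n b) : ∃ C : ℝ, ∀ i x, ‖a i x * b i x‖ ≤ C := by
  obtain ⟨C, hC⟩ := ha.bdd
  obtain ⟨C', hC'⟩ := hb.bdd
  refine ⟨C * C', fun i x => ?_⟩
  rw [norm_mul]
  exact mul_le_mul (hC i x) (hC' i x) (norm_nonneg _) ((norm_nonneg _).trans (hC i x))

lemma DirBdd.add {n : ℕ} {a b : ι → E → ℂ} (ha : DirBdd e n a) (hb : DirBdd e n b)
    (ha' : ∀ i, ContDiff ℝ ∞ (a i)) (hb' : ∀ i, ContDiff ℝ ∞ (b i)) :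
    DirBdd e n (fun i x => a i x + b i x) := by
  induction n generalizing a b with
  | zero => exact ha.exists_norm_add_le hb
  | succ n ih =>
    refine ⟨ha.exists_norm_add_le hb, ?_⟩
    convert! ih ha.2 hb.2 (fun i => (ha' i).fderiv_apply_const _)
      (fun i => (hb' i).fderiv_apply_const _) using 3 with i x
    rw [fderiv_fun_add ((ha' i).differentiable_of_infty x) ((hb' i).differentiable_of_infty x)]
    rfl

lemma DirBdd.mul {n : ℕ} {a b : ι → E → ℂ} (ha : DirBdd e n a) (hb : DirBdd e n b)
    (ha' : ∀ i, ContDiff ℝ ∞ (a i)) (hb' : ∀ i, ContDiff ℝ ∞ (b i)) :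
    DirBdd e n (fun i x => a i x * b i x) := by
  induction n generalizing a b with
  | zero => exact ha.exists_norm_mul_le hb
  | succ n ih =>
    refine ⟨ha.exists_norm_mul_le hb, ?_⟩
    have hda := fun i => (ha' i).fderiv_apply_const (e i)
    have hdb := fun i => (hb' i).fderiv_apply_const (e i)
    have h1 := ih ha.of_succ hb.2 ha' hdb
    have h2 := ih hb.of_succ ha.2 hb' hda
    convert! h1.add h2 (fun i => (ha' i).mul (hdb i)) (fun i => (hb' i).mul (hda i))
      using 3 with i x
    rw [fderiv_fun_mul ((ha' i).differentiable_of_infty x) ((hb' i).differentiable_of_infty x)]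
    simp

lemma DirBdd.neg {n : ℕ} {a : ι → E → ℂ} (ha : DirBdd e n a) :
    DirBdd e n (fun i x => -a i x) := by
  induction n generalizing a with
  | zero =>
    obtain ⟨C, hC⟩ := ha.bdd
    exact ⟨C, fun i x => by rw [norm_neg]; exact hC i x⟩
  | succ n ih =>
    refine ⟨?_, ?_⟩
    · obtain ⟨C, hC⟩ := ha.bdd
      exact ⟨C, fun i x => by rw [norm_neg]; exact hC i x⟩
    · convert! ih ha.2 using 3 with i x
      rw [fderiv_fun_neg]
      rfl

lemma DirBdd.inv {n : ℕ} {a : ι → E → ℂ} (ha : DirBdd e n a)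
    (ha' : ∀ i, ContDiff ℝ ∞ (a i)) {c : ℝ} (hc : 0 < c) (hac : ∀ i x, c ≤ ‖a i x‖) :
    DirBdd e n (fun i x => (a i x)⁻¹) := by
  have h0 : ∃ C : ℝ, ∀ i x, ‖(a i x)⁻¹‖ ≤ C :=
    ⟨c⁻¹, fun i x => by rw [norm_inv]; exact inv_anti₀ hc (hac i x)⟩
  have hne : ∀ i x, a i x ≠ 0 := fun i x => norm_pos_iff.1 (hc.trans_le (hac i x))
  have hinv : ∀ i, ContDiff ℝ ∞ (fun x => (a i x)⁻¹) := fun i => (ha' i).inv (hne i)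
  induction n with
  | zero => exact h0
  | succ n ih =>
    refine ⟨h0, ?_⟩
    have hda := fun i => (ha' i).fderiv_apply_const (e i)
    have h1 := ((ih ha.of_succ).mul (ih ha.of_succ) hinv hinv).mul ha.2
      (fun i => (hinv i).mul (hinv i)) hda
    convert! h1.neg using 3 with i x
    have h2 : HasFDerivAt (fun x => (a i x)⁻¹) _ x :=
      (hasFDerivAt_inv (hne i x)).restrictScalars ℝ |>.comp x
        ((ha' i).differentiable_of_infty x).hasFDerivAt
    rw [h2.fderiv]
    simp
    ring

lemma HasCompactSupport.exists_norm_fderiv_le {F : Type*} [NormedAddCommGroup F] [NormedSpace ℝ F]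
    {A : E → F} (hA : ContDiff ℝ ∞ A) (hc : HasCompactSupport A) :
    ∃ C : ℝ, ∀ x, ‖fderiv ℝ A x‖ ≤ C :=
  (hc.fderiv ℝ).exists_bound_of_continuous (hA.continuous_fderiv (by simp))

lemma norm_comp_apply_le {F : Type*} [NormedAddCommGroup F] [NormedSpace ℝ F] (L : F →L[ℝ] ℂ)
    {w : E} (hw : ‖w‖ ≤ 1) :
    ‖L ∘L (ContinuousLinearMap.apply ℝ F w : (E →L[ℝ] F) →L[ℝ] F)‖ ≤ ‖L‖ := by
  refine ContinuousLinearMap.opNorm_le_bound _ (norm_nonneg _) fun B => ?_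
  simp only [ContinuousLinearMap.comp_apply, ContinuousLinearMap.apply_apply]
  refine (L.le_opNorm _).trans ?_
  gcongr
  refine (B.le_opNorm w).trans ?_
  exact mul_le_of_le_one_right (norm_nonneg _) hw

/-- Translates of a compactly supported smooth function, composed with bounded functionals, have
uniformly bounded directional derivatives. The vector-valued `A` lets the induction pass from `A`
to its Fréchet derivative. -/
lemma DirBdd.of_hasCompactSupport (he : ∀ i, ‖e i‖ ≤ 1) (w : ι → E) {K : ℝ} (n : ℕ) {F : Type u}
    [NormedAddCommGroup F] [NormedSpace ℝ F] {A : E → F} (hA : ContDiff ℝ ∞ A)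
    (hc : HasCompactSupport A) {L : ι → F →L[ℝ] ℂ} (hL : ∀ i, ‖L i‖ ≤ K) :
    DirBdd e n (fun i x => L i (A (x + w i))) := by
  induction n generalizing F with
  | zero =>
    obtain ⟨C, hC⟩ := hc.exists_bound_of_continuous hA.continuous
    exact ⟨K * C, fun i x => ((L i).le_opNorm _).trans
      (mul_le_mul (hL i) (hC _) (norm_nonneg _) ((norm_nonneg _).trans (hL i)))⟩
  | succ n ih =>
    refine ⟨?_, ?_⟩
    · obtain ⟨C, hC⟩ := hc.exists_bound_of_continuous hA.continuous
      exact ⟨K * C, fun i x => ((L i).le_opNorm _).trans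
        (mul_le_mul (hL i) (hC _) (norm_nonneg _) ((norm_nonneg _).trans (hL i)))⟩
    · convert! ih (hA.fderiv_right (m := ∞) (by simp)) (hc.fderiv ℝ)
        (L := fun i => L i ∘L ContinuousLinearMap.apply ℝ F (e i))
        (fun i => (norm_comp_apply_le _ (he i)).trans (hL i)) using 3 with i x
      have h1 : HasFDerivAt (fun x => L i (A (x + w i))) (L i ∘L fderiv ℝ A (x + w i)) x :=
        (L i).hasFDerivAt.comp x
          ((hasFDerivAt_comp_add_right (w i)).2 (hA.differentiable_of_infty (x + w i)).hasFDerivAt)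
      rw [h1.fderiv]
      rfl

lemma exists_norm_differenceQuotient_le {w : ι → E} {ρ : ι → ℝ} (hρ : ∀ i, 0 < ρ i)
    (hw : ∀ i, ‖w i‖ ≤ ρ i) {K : ℝ} {F : Type*} [NormedAddCommGroup F] [NormedSpace ℝ F]
    {A : E → F} (hA : ContDiff ℝ ∞ A) (hc : HasCompactSupport A) {L : ι → F →L[ℝ] ℂ}
    (hL : ∀ i, ‖L i‖ ≤ K) : ∃ C : ℝ, ∀ i x, ‖L i ((ρ i)⁻¹ • (A (x + w i) - A x))‖ ≤ C := by
  obtain ⟨C, hC⟩ := hc.exists_norm_fderiv_le hA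
  refine ⟨K * C, fun i x => ((L i).le_opNorm _).trans
    (mul_le_mul (hL i) ?_ (norm_nonneg _) ((norm_nonneg _).trans (hL i)))⟩
  have h1 : ‖A (x + w i) - A x‖ ≤ C * ‖x + w i - x‖ :=
    convex_univ.norm_image_sub_le_of_norm_fderiv_le
      (fun y _ => hA.differentiable_of_infty y) (fun y _ => hC y) (Set.mem_univ _) (Set.mem_univ _)
  rw [add_sub_cancel_left] at h1
  rw [norm_smul, norm_inv, Real.norm_of_nonneg (hρ i).le, inv_mul_le_iff₀ (hρ i)]
  have hC0 : 0 ≤ C := (norm_nonneg _).trans (hC 0)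
  nlinarith [hw i]

/-- Difference quotients of a compactly supported smooth function have directional derivatives
bounded uniformly in the step `w i`, however small: a derivative of the quotient is the quotient of
a derivative, and each quotient is bounded by the mean value inequality. -/
lemma DirBdd.of_differenceQuotient (he : ∀ i, ‖e i‖ ≤ 1) {w : ι → E} {ρ : ι → ℝ}
    (hρ : ∀ i, 0 < ρ i) (hw : ∀ i, ‖w i‖ ≤ ρ i) {K : ℝ} (n : ℕ) {F : Type u}
    [NormedAddCommGroup F] [NormedSpace ℝ F] {A : E → F} (hA : ContDiff ℝ ∞ A)
    (hc : HasCompactSupport A) {L : ι → F →L[ℝ] ℂ} (hL : ∀ i, ‖L i‖ ≤ K) :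
    DirBdd e n (fun i x => L i ((ρ i)⁻¹ • (A (x + w i) - A x))) := by
  induction n generalizing F with
  | zero => exact exists_norm_differenceQuotient_le hρ hw hA hc hL
  | succ n ih =>
    refine ⟨exists_norm_differenceQuotient_le hρ hw hA hc hL, ?_⟩
    convert! ih (hA.fderiv_right (m := ∞) (by simp)) (hc.fderiv ℝ)
      (L := fun i => L i ∘L ContinuousLinearMap.apply ℝ F (e i))
      (fun i => (norm_comp_apply_le _ (he i)).trans (hL i)) using 3 with i x
    have h1 : HasFDerivAt (fun x => L i ((ρ i)⁻¹ • (A (x + w i) - A x)))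
        (L i ∘L ((ρ i)⁻¹ • (fderiv ℝ A (x + w i) - fderiv ℝ A x))) x :=
      (L i).hasFDerivAt.comp x
        ((((hasFDerivAt_comp_add_right (w i)).2
          (hA.differentiable_of_infty (x + w i)).hasFDerivAt).sub
          (hA.differentiable_of_infty x).hasFDerivAt).const_smul ((ρ i)⁻¹))
    rw [h1.fderiv]
    rfl

lemma DirBdd.const_add {n : ℕ} {a : ι → E → ℂ} (ha : DirBdd e n a) (c : ℂ) :
    DirBdd e n (fun i x => c + a i x) := by
  cases n with
  | zero =>
    obtain ⟨C, hC⟩ := ha.bdd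
    exact ⟨‖c‖ + C, fun i x => (norm_add_le _ _).trans (by gcongr; exact hC i x)⟩
  | succ n =>
    refine ⟨?_, ?_⟩
    · obtain ⟨C, hC⟩ := ha.bdd
      exact ⟨‖c‖ + C, fun i x => (norm_add_le _ _).trans (by gcongr; exact hC i x)⟩
    · convert! ha.2 using 3 with i x
      rw [fderiv_const_add]

end DirectionalBounds

/-! ### Non-stationary phase -/

section NonStationary

universe u v

variable {ι : Type v} {E : Type u} [NormedAddCommGroup E] [NormedSpace ℝ E]
  [FiniteDimensional ℝ E] [MeasurableSpace E] [BorelSpace E] {μ : Measure E}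
  [μ.IsAddHaarMeasure]

/-- Non-stationary phase, uniformly in a family of phases `θ` and amplitudes `b i`: if
`∂_{e i} θ = λ g` with `|g| ≥ c`, then `N` integrations by parts in the direction `e i` gain
`|λ|⁻ᴺ`. -/
theorem exists_norm_integral_exp_mul_le {e : ι → E} {g b : ι → E → ℂ}
    (hg : ∀ n, DirBdd e n g) (hg' : ∀ i, ContDiff ℝ ∞ (g i)) {c : ℝ} (hc : 0 < c)
    (hgc : ∀ i x, c ≤ ‖g i x‖) {R : ℝ} (N : ℕ)
    (hb : ∀ n, DirBdd e n b) (hb' : ∀ i, ContDiff ℝ ∞ (b i))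
    (hbR : ∀ i x, R < ‖x‖ → b i x = 0) :
    ∃ C : ℝ, ∀ i, ∀ l : ℝ, l ≠ 0 → ∀ θ : E → ℝ, ContDiff ℝ ∞ θ →
      (∀ x, (fderiv ℝ θ x (e i) : ℂ) = l * g i x) →
      ‖∫ x, Complex.exp (θ x * Complex.I) * b i x ∂μ‖ ≤ C / |l| ^ N := by
  induction N generalizing b with
  | zero =>
    obtain ⟨C, hC⟩ := (hb 0).bdd
    refine ⟨C * μ.real (Metric.closedBall 0 R), fun i l _ θ _ _ => ?_⟩
    have h1 : ∫ x, Complex.exp (θ x * Complex.I) * b i x ∂μ =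
        ∫ x in Metric.closedBall 0 R, Complex.exp (θ x * Complex.I) * b i x ∂μ := by
      refine (setIntegral_eq_integral_of_forall_compl_eq_zero fun x hx => ?_).symm
      rw [hbR i x (by simpa using hx), mul_zero]
    rw [h1, pow_zero, div_one]
    refine norm_setIntegral_le_of_norm_le_const (measure_closedBall_lt_top) fun x _ => ?_
    rw [norm_mul, Complex.norm_exp_ofReal_mul_I, one_mul]
    exact hC i x
  | succ N ih =>
    have hne : ∀ i x, g i x ≠ 0 := fun i x => norm_pos_iff.1 (hc.trans_le (hgc i x))
    have hinv : ∀ i, ContDiff ℝ ∞ (fun x => (g i x)⁻¹) := fun i => (hg' i).inv (hne i)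
    let q : ι → E → ℂ := fun i x => b i x * (g i x)⁻¹
    have hq' : ∀ i, ContDiff ℝ ∞ (q i) := fun i => (hb' i).mul (hinv i)
    have hq : ∀ n, DirBdd e n q := fun n =>
      (hb n).mul ((hg n).inv hg' hc hgc) hb' hinv
    have hqR : ∀ i x, R < ‖x‖ → q i x = 0 := fun i x hx => by simp [q, hbR i x hx]
    have hdR : ∀ i x, R < ‖x‖ → fderiv ℝ (q i) x (e i) = 0 := by
      intro i x hx
      have : q i =ᶠ[nhds x] fun _ => 0 := by
        filter_upwards [(isOpen_lt continuous_const continuous_norm).mem_nhds hx] with y hy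
        exact hqR i y hy
      rw [this.fderiv_eq]
      simp
    obtain ⟨C, hC⟩ := ih (b := fun i x => fderiv ℝ (q i) x (e i)) (fun n => (hq (n + 1)).2)
      (fun i => (hq' i).fderiv_apply_const _) hdR
    refine ⟨C, fun i l hl θ hθ hθg => ?_⟩
    have hsupp : ∀ f : E → ℂ, Continuous f → (∀ x, R < ‖x‖ → f x = 0) → Integrable f μ := by
      intro f hf hfR
      refine hf.integrable_of_hasCompactSupport
        (HasCompactSupport.intro (isCompact_closedBall (0 : E) R) fun x hx => hfR x ?_)
      simpa using hx
    let w : E → ℂ := fun x => Complex.exp (θ x * Complex.I)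
    have hwθ : ContDiff ℝ ∞ w :=
      ((Complex.ofRealCLM.contDiff.comp hθ).mul contDiff_const).cexp
    have hwd : ∀ x, fderiv ℝ w x (e i) = w x * (l * g i x * Complex.I) := by
      intro x
      have h1 : HasFDerivAt (fun x => (θ x : ℂ)) (Complex.ofRealCLM ∘L fderiv ℝ θ x) x :=
        Complex.ofRealCLM.hasFDerivAt.comp x (hθ.differentiable_of_infty x).hasFDerivAt
      have h2 : HasFDerivAt w _ x := (h1.mul_const Complex.I).cexp
      rw [h2.fderiv]
      simp only [smul_apply, ContinuousLinearMap.comp_apply,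
        Complex.ofRealCLM_apply, smul_eq_mul, hθg x, w]
      ring
    have hcq := (hq' i).continuous
    have hcdq := ((hq' i).fderiv_apply_const (e i)).continuous
    have hcdw := (hwθ.fderiv_apply_const (e i)).continuous
    have hibp := integral_mul_fderiv_eq_neg_fderiv_mul_of_integrable (μ := μ) (f := q i) (g := w)
      (v := e i)
      (hsupp _ (hcdq.mul hwθ.continuous) fun x hx => by rw [hdR i x hx, zero_mul])
      (hsupp _ (hcq.mul hcdw) fun x hx => by rw [hqR i x hx, zero_mul])
      (hsupp _ (hcq.mul hwθ.continuous) fun x hx => by rw [hqR i x hx, zero_mul])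
      (fun x _ => (hq' i).differentiable_of_infty x) (fun x _ => hwθ.differentiable_of_infty x)
    have h3 : ∀ x, q i x * fderiv ℝ w x (e i) =
        (l * Complex.I) * (Complex.exp (θ x * Complex.I) * b i x) := by
      intro x
      rw [hwd]
      simp only [q, w]
      field_simp [hne i x]
    simp only [h3] at hibp
    rw [integral_const_mul] at hibp
    have h4 := congrArg norm hibp
    rw [norm_mul, norm_neg, norm_mul, Complex.norm_I, mul_one, Complex.norm_real,
      Real.norm_eq_abs] at h4
    have h5 := hC i l hl θ hθ hθg
    simp only [w, mul_comm (fderiv ℝ (q i) _ (e i))] at h4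
    rw [pow_succ, ← div_div, le_div_iff₀ (abs_pos.2 hl), mul_comm, h4]
    exact h5

end NonStationary

/-! ### A strongly monotone extension of the phase -/

section GlobalPhase

/-- A smooth function `w` that agrees with `s ↦ (α / 2) s ^ (α / 2 - 1)` on `[1/4, 16]`, and is
monotone, positive, and constant far out. -/
lemma exists_monotone_extension_rpow {α : ℝ} (hα : 2 < α) :
    ∃ (w : ℝ → ℝ) (c : ℝ), 0 < c ∧ ContDiff ℝ ∞ w ∧ Monotone w ∧ (∀ s, c ≤ w s) ∧
      (∀ s, 17 ≤ s → w s = w 17) ∧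
      ∀ s ∈ Set.Icc (1 / 4 : ℝ) 16, w s = α / 2 * s ^ (α / 2 - 1) := by
  -- `k` is the identity on `[1/4, 16]` and constant outside `[1/8, 17]`
  let b : ContDiffBump (65 / 8 : ℝ) := ⟨63 / 8, 8, by norm_num, by norm_num⟩
  have hbc : Continuous b := b.continuous
  let k : ℝ → ℝ := fun s => 1 / 4 + ∫ u in (1 / 4 : ℝ)..s, b u
  have hkd : ∀ s, HasDerivAt k (b s) s := fun s =>
    (hbc.integral_hasStrictDerivAt (1 / 4) s).hasDerivAt.const_add _
  have hk : ContDiff ℝ ∞ k := by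
    rw [contDiff_infty_iff_deriv]
    refine ⟨fun s => (hkd s).differentiableAt, ?_⟩
    rw [funext fun s => (hkd s).deriv]
    exact b.contDiff
  have hkm : Monotone k :=
    monotone_of_hasDerivAt_nonneg hkd (fun s => b.nonneg)
  have hk_id : ∀ s ∈ Set.Icc (1 / 4 : ℝ) 16, k s = s := by
    intro s hs
    have : ∫ u in (1 / 4 : ℝ)..s, b u = ∫ u in (1 / 4 : ℝ)..s, (1 : ℝ) := by
      refine intervalIntegral.integral_congr fun u hu => ?_
      rw [Set.uIcc_of_le hs.1] at hu
      refine b.one_of_mem_closedBall ?_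
      rw [Metric.mem_closedBall, Real.dist_eq, abs_le]
      constructor <;> simp only [b] <;> linarith [hu.1, hu.2, hs.2]
    simp only [k, this]
    simp
  have hb0 : ∀ u, u ≤ 1 / 8 ∨ 17 ≤ u → b u = 0 := by
    intro u hu
    refine b.zero_of_le_dist ?_
    rw [Real.dist_eq]
    rcases hu with hu | hu
    · rw [abs_of_nonpos (by linarith)]
      simp only [b]
      linarith
    · rw [abs_of_nonneg (by linarith)]
      simp only [b]
      linarith
  have hk_far : ∀ s, 17 ≤ s → k s = k 17 := by
    intro s hs
    have h1 : (∫ u in (1 / 4 : ℝ)..17, b u) + ∫ u in (17 : ℝ)..s, b u =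
        ∫ u in (1 / 4 : ℝ)..s, b u :=
      intervalIntegral.integral_add_adjacent_intervals (hbc.intervalIntegrable _ _)
        (hbc.intervalIntegrable _ _)
    have h2 : ∫ u in (17 : ℝ)..s, b u = ∫ u in (17 : ℝ)..s, (0 : ℝ) := by
      refine intervalIntegral.integral_congr fun u hu => ?_
      rw [Set.uIcc_of_le hs] at hu
      exact hb0 u (Or.inr hu.1)
    simp only [k, ← h1, h2]
    simp
  have hk8 : 1 / 8 ≤ k (1 / 8) := by
    have h1 : ∫ u in (1 / 8 : ℝ)..(1 / 4), b u ≤ ∫ u in (1 / 8 : ℝ)..(1 / 4), (1 : ℝ) :=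
      intervalIntegral.integral_mono_on (by norm_num) (hbc.intervalIntegrable _ _)
        (continuous_const.intervalIntegrable _ _) fun u _ => b.le_one
    have h2 : k (1 / 8) = 1 / 4 - ∫ u in (1 / 8 : ℝ)..(1 / 4), b u := by
      simp only [k]
      rw [intervalIntegral.integral_symm]
      ring
    rw [h2]
    simp at h1
    linarith
  have hk_low : ∀ s, 1 / 8 ≤ k s := by
    intro s
    rcases le_total (1 / 8) s with hs | hs
    · exact hk8.trans (hkm hs)
    · have h1 : (∫ u in (1 / 4 : ℝ)..(1 / 8), b u) + ∫ u in (1 / 8 : ℝ)..s, b u =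
          ∫ u in (1 / 4 : ℝ)..s, b u :=
        intervalIntegral.integral_add_adjacent_intervals (hbc.intervalIntegrable _ _)
          (hbc.intervalIntegrable _ _)
      have h2 : ∫ u in (1 / 8 : ℝ)..s, b u = ∫ u in (1 / 8 : ℝ)..s, (0 : ℝ) := by
        refine intervalIntegral.integral_congr fun u hu => ?_
        rw [Set.uIcc_of_ge hs] at hu
        exact hb0 u (Or.inl hu.2)
      have h3 : k s = k (1 / 8) := by
        simp only [k, ← h1, h2]
        simp
      rw [h3]
      exact hk8
  have hkpos : ∀ s, 0 < k s := fun s => lt_of_lt_of_le (by norm_num) (hk_low s)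
  refine ⟨fun s => α / 2 * k s ^ (α / 2 - 1), α / 2 * (1 / 8) ^ (α / 2 - 1), by positivity,
    contDiff_const.mul (hk.rpow_const_of_ne fun s => (hkpos s).ne'), ?_, ?_, ?_, ?_⟩
  · intro s s' hss
    have := hkm hss
    have := hkpos s
    have : 0 ≤ α / 2 - 1 := by linarith
    simp only
    gcongr
  · intro s
    have := hk_low s
    have : 0 ≤ α / 2 - 1 := by linarith
    simp only
    gcongr
  · intro s hs
    simp only [hk_far s hs]
  · intro s hs
    simp only [hk_id s hs]

/-- The phase `|ξ|^α` on the annulus `1/2 ≤ |ξ| ≤ 4` extends to a smooth `Φ` whose gradient is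
strongly monotone and, up to a linear map, compactly supported. Half the gradient is `w(|ξ|²) ξ`
with `w` positive and monotone, and strong monotonicity rests on
`2 ⟪μ a - ν b, a - b⟫ = (μ + ν) |a - b|² + (μ - ν) (|a|² - |b|²)` for `μ = w(|a|²)` and
`ν = w(|b|²)`. -/
lemma exists_global_phase {E : Type*} [NormedAddCommGroup E] [InnerProductSpace ℝ E]
    [FiniteDimensional ℝ E] {α : ℝ} (hα : 2 < α) :
    ∃ (Φ : E → ℝ) (X : E → E) (k c : ℝ), 0 < c ∧ ContDiff ℝ ∞ Φ ∧ ContDiff ℝ ∞ X ∧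
      HasCompactSupport X ∧
      (∀ ξ v, fderiv ℝ Φ ξ v = inner ℝ v (X ξ) + k * inner ℝ v ξ) ∧
      (∀ ξ h, c * ‖h‖ ^ 2 ≤ fderiv ℝ Φ (ξ + h) h - fderiv ℝ Φ ξ h) ∧
      ∀ ξ, 1 / 2 ≤ ‖ξ‖ → ‖ξ‖ ≤ 4 → Φ ξ = ‖ξ‖ ^ α := by
  obtain ⟨w, c, hc, hw, hwm, hwc, hw17, hweq⟩ := exists_monotone_extension_rpow hα
  let W : ℝ → ℝ := fun s => (1 / 4) ^ (α / 2) + ∫ u in (1 / 4 : ℝ)..s, w u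
  have hWd : ∀ s, HasDerivAt W (w s) s := fun s =>
    (hw.continuous.integral_hasStrictDerivAt (1 / 4) s).hasDerivAt.const_add _
  have hW : ContDiff ℝ ∞ W := by
    rw [contDiff_infty_iff_deriv]
    refine ⟨fun s => (hWd s).differentiableAt, ?_⟩
    rw [funext fun s => (hWd s).deriv]
    exact hw
  have hWeq : ∀ s ∈ Set.Icc (1 / 4 : ℝ) 16, W s = s ^ (α / 2) := by
    intro s hs
    have h1 : ∫ u in (1 / 4 : ℝ)..s, w u = s ^ (α / 2) - (1 / 4) ^ (α / 2) := by
      refine intervalIntegral.integral_eq_sub_of_hasDerivAt (f := fun u => u ^ (α / 2)) ?_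
        (hw.continuous.intervalIntegrable _ _)
      intro u hu
      rw [Set.uIcc_of_le hs.1] at hu
      rw [hweq u ⟨hu.1, hu.2.trans hs.2⟩]
      exact Real.hasDerivAt_rpow_const (Or.inl (by linarith [hu.1]))
    simp only [W, h1]
    ring
  have hns : ContDiff ℝ ∞ (fun ξ : E => ‖ξ‖ ^ 2) := contDiff_norm_sq ℝ
  have hfd : ∀ ξ v : E, fderiv ℝ (fun ξ : E => W (‖ξ‖ ^ 2)) ξ v =
      2 * w (‖ξ‖ ^ 2) * inner ℝ v ξ := by
    intro ξ v
    have h1 : HasFDerivAt (fun ξ : E => W (‖ξ‖ ^ 2)) _ ξ :=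
      HasDerivAt.comp_hasFDerivAt (h₂ := W) ξ (hWd (‖ξ‖ ^ 2))
        (hasStrictFDerivAt_norm_sq ξ).hasFDerivAt
    rw [h1.fderiv]
    simp [real_inner_comm]
    ring
  refine ⟨fun ξ => W (‖ξ‖ ^ 2), fun ξ => (2 * w (‖ξ‖ ^ 2) - 2 * w 17) • ξ, 2 * w 17, 2 * c,
    by positivity, hW.comp hns, ?_, ?_, ?_, ?_, ?_⟩
  · exact (((contDiff_const.mul (hw.comp hns))).sub contDiff_const).smul contDiff_id
  · refine HasCompactSupport.intro (isCompact_closedBall (0 : E) 5) fun ξ hξ => ?_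
    have : 5 < ‖ξ‖ := by simpa using hξ
    rw [hw17 (‖ξ‖ ^ 2) (by nlinarith)]
    simp
  · intro ξ v
    rw [hfd, inner_smul_right]
    ring
  · intro ξ h
    rw [hfd, hfd]
    have h1 : ‖ξ + h‖ ^ 2 = ‖ξ‖ ^ 2 + 2 * inner ℝ h ξ + ‖h‖ ^ 2 := by
      rw [norm_add_sq_real, real_inner_comm]
    have h2 : inner ℝ h (ξ + h) = inner ℝ h ξ + ‖h‖ ^ 2 := by
      rw [inner_add_right, real_inner_self_eq_norm_sq]
    rw [h2]
    set a := ‖ξ + h‖ ^ 2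
    set b := ‖ξ‖ ^ 2
    have h3 : 0 ≤ (w a - w b) * (a - b) := by
      rcases le_total a b with hab | hab
      · exact mul_nonneg_of_nonpos_of_nonpos (sub_nonpos.2 (hwm hab)) (sub_nonpos.2 hab)
      · exact mul_nonneg (sub_nonneg.2 (hwm hab)) (sub_nonneg.2 hab)
    have h4 : 0 ≤ (w a + w b - 2 * c) * ‖h‖ ^ 2 :=
      mul_nonneg (by linarith [hwc a, hwc b]) (sq_nonneg _)
    have h5 : inner ℝ h ξ = (a - b - ‖h‖ ^ 2) / 2 := by linarith
    rw [h5]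
    nlinarith
  · intro ξ h1 h2
    simp only
    rw [hWeq _ ⟨by nlinarith, by nlinarith⟩, ← Real.rpow_natCast, ← Real.rpow_mul (norm_nonneg _)]
    congr 1
    push_cast
    ring

end GlobalPhase

/-! ### The dispersive estimate -/

section Dispersive

variable {E : Type} [NormedAddCommGroup E] [InnerProductSpace ℝ E] [FiniteDimensional ℝ E]
  [MeasurableSpace E] [BorelSpace E]

/-- The square of an integral is the integral over `h` of the autocorrelations at lag `h`. -/
lemma integral_mul_conj_integral {f : E → ℂ} (hf : Continuous f) (hc : HasCompactSupport f) :
    (∫ ξ, f ξ) * (starRingEnd ℂ) (∫ ξ, f ξ) =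
      ∫ h, ∫ η, f (η + h) * (starRingEnd ℂ) (f η) := by
  have hcont : Continuous (Function.uncurry fun η h : E => f (η + h) * (starRingEnd ℂ) (f η)) := by
    unfold Function.uncurry
    fun_prop
  obtain ⟨R, hR⟩ := hc.isCompact.isBounded.subset_closedBall 0
  have hz : ∀ x, R < ‖x‖ → f x = 0 := fun x hx => by
    by_contra h
    have := hR (subset_tsupport f h)
    simp at this
    linarith
  have hint : Integrable (Function.uncurry fun η h : E => f (η + h) * (starRingEnd ℂ) (f η))
      (volume.prod volume) := by
    refine hcont.integrable_of_hasCompactSupport (HasCompactSupport.intro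
      ((isCompact_closedBall (0 : E) R).prod (isCompact_closedBall (0 : E) (2 * R))) ?_)
    rintro ⟨η, h⟩ hηh
    simp only [Function.uncurry]
    by_cases h1 : ‖η‖ ≤ R
    · have h2 : 2 * R < ‖h‖ := by
        by_contra h3
        exact hηh ⟨by simpa using h1, by simpa using h3⟩
      have h3 : R < ‖η + h‖ := by
        have := norm_sub_le (η + h) η
        rw [add_sub_cancel_left] at this
        linarith
      rw [hz _ h3, zero_mul]
    · rw [hz η (not_le.1 h1), map_zero, mul_zero]
  rw [← integral_integral_swap hint, ← integral_conj, ← integral_const_mul]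
  refine integral_congr_ae (Filter.Eventually.of_forall fun η => ?_)
  simp only
  rw [integral_mul_const, integral_add_left_eq_self]

/-- Stationary phase for a phase with uniformly monotone gradient, uniformly in linear
perturbations of the phase. The square of the integral is `∫ J(h) dh` where the phase of `J(h)` is
the difference `Φ(η + h) - Φ(η)`; its derivative in the direction of `h` is at least `c |h|`, so
`J(h)` decays like `(1 + |t| |h|)⁻ᴺ`, and integrating in `h` yields `|t|^{-d}`. -/
theorem exists_norm_oscillatory_integral_le [Nontrivial E] {Φ : E → ℝ} (hΦ : ContDiff ℝ ∞ Φ)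
    {X : E → E} (hX : ContDiff ℝ ∞ X) (hXc : HasCompactSupport X) {k c : ℝ} (hc : 0 < c)
    (hgrad : ∀ ξ v, fderiv ℝ Φ ξ v = inner ℝ v (X ξ) + k * inner ℝ v ξ)
    (hmono : ∀ ξ h, c * ‖h‖ ^ 2 ≤ fderiv ℝ Φ (ξ + h) h - fderiv ℝ Φ ξ h)
    {χ : E → ℂ} (hχ : ContDiff ℝ ∞ χ) (hχc : HasCompactSupport χ) :
    ∃ C : ℝ, ∀ (t : ℝ) (y : E),
      ‖∫ ξ, Complex.exp ((t * Φ ξ + inner ℝ y ξ : ℝ) * Complex.I) * χ ξ‖ ≤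
        C * (1 + |t|) ^ (-((Module.finrank ℝ E : ℝ) / 2)) := by
  set d := Module.finrank ℝ E with hd
  let ι := {h : E // h ≠ 0}
  have hpos : ∀ h : ι, 0 < ‖(h : E)‖ := fun h => norm_pos_iff.2 h.2
  let e : ι → E := fun h => ‖(h : E)‖⁻¹ • (h : E)
  have he : ∀ h, ‖e h‖ ≤ 1 := fun h => by
    simp only [e, norm_smul, norm_inv, norm_norm]
    rw [inv_mul_cancel₀ (hpos h).ne']
  let L : ι → E →L[ℝ] ℂ := fun h => Complex.ofRealCLM ∘L innerSL ℝ (e h)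
  have hL : ∀ h, ‖L h‖ ≤ 1 := fun h => by
    refine ContinuousLinearMap.opNorm_le_bound _ zero_le_one fun v => ?_
    simp only [L, ContinuousLinearMap.comp_apply, innerSL_apply_apply, Complex.ofRealCLM_apply,
      Complex.norm_real]
    refine (norm_inner_le_norm _ _).trans ?_
    gcongr
    exact he h
  -- `|h| g h` is the derivative of `Φ(· + h) - Φ` in the direction `e h`
  let g : ι → E → ℂ := fun h x =>
    (k : ℂ) + L h (‖(h : E)‖⁻¹ • (X (x + h) - X x))
  have hg : ∀ n, DirBdd e n g := fun n =>
    (DirBdd.of_differenceQuotient he hpos (fun _ => le_rfl) n hX hXc hL).const_add _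
  have hg' : ∀ h, ContDiff ℝ ∞ (g h) := fun h =>
    contDiff_const.add ((L h).contDiff.comp
      (((hX.comp (contDiff_id.add contDiff_const)).sub hX).const_smul _))
  have hg_eq : ∀ (h : ι) x,
      ((fderiv ℝ Φ (x + h) (e h) - fderiv ℝ Φ x (e h) : ℝ) : ℂ) = ‖(h : E)‖ * g h x := by
    intro h x
    have h1 : (‖(h : E)‖ : ℂ) ≠ 0 := by exact_mod_cast (hpos h).ne'
    have h2 : inner ℝ (e h) (h : E) = ‖(h : E)‖ := by
      simp only [e, real_inner_smul_left, real_inner_self_eq_norm_sq]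
      field_simp [(hpos h).ne']
    simp only [hgrad, g, L, ContinuousLinearMap.comp_apply, innerSL_apply_apply,
      Complex.ofRealCLM_apply, inner_smul_right, inner_add_right, inner_sub_right, h2]
    push_cast
    field_simp
    ring
  have hgc : ∀ h x, c ≤ ‖g h x‖ := by
    intro h x
    have h1 := hmono x h
    have h2 : (h : E) = ‖(h : E)‖ • e h := by
      simp only [e, smul_smul, mul_inv_cancel₀ (hpos h).ne', one_smul]
    have h3 : fderiv ℝ Φ (x + h) h - fderiv ℝ Φ x h =
        ‖(h : E)‖ * (fderiv ℝ Φ (x + h) (e h) - fderiv ℝ Φ x (e h)) := by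
      have h3' : ∀ B : E →L[ℝ] ℝ, B h = ‖(h : E)‖ * B (e h) := fun B => by
        rw [← smul_eq_mul, ← map_smul, ← h2]
      rw [h3' (fderiv ℝ Φ (x + h)), h3' (fderiv ℝ Φ x), mul_sub]
    have h4 := congrArg norm (hg_eq h x)
    rw [norm_mul, Complex.norm_real, Complex.norm_real, norm_norm, Real.norm_eq_abs] at h4
    rw [h3, sq, ← mul_assoc, mul_comm c, mul_assoc] at h1
    have h5 := le_of_mul_le_mul_left h1 (hpos h)
    have h6 : c * ‖(h : E)‖ ≤ ‖(h : E)‖ * ‖g h x‖ := by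
      rw [← h4]
      exact h5.trans (le_abs_self _)
    rw [mul_comm] at h6
    exact le_of_mul_le_mul_left h6 (hpos h)
  let b : ι → E → ℂ := fun h x => χ (x + h) * (starRingEnd ℂ) (χ x)
  have hconj : ContDiff ℝ ∞ (fun x => (starRingEnd ℂ) (χ x)) :=
    Complex.conjCLE.contDiff.comp hχ
  have hb' : ∀ h, ContDiff ℝ ∞ (b h) := fun h =>
    (hχ.comp (contDiff_id.add contDiff_const)).mul hconj
  have hshift : ∀ h : ι, ContDiff ℝ ∞ (fun x => χ (x + h)) := fun h =>
    hχ.comp (contDiff_id.add contDiff_const)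
  have hb : ∀ n, DirBdd e n b := fun n => by
    have h1 := DirBdd.of_hasCompactSupport he (fun h => (h : E)) n hχ hχc
      (L := fun _ => ContinuousLinearMap.id ℝ ℂ) (fun _ => le_rfl)
    have h2 := DirBdd.of_hasCompactSupport he (fun _ => (0 : E)) n hconj
      (hχc.comp_left (map_zero (starRingEnd ℂ)))
      (L := fun _ => ContinuousLinearMap.id ℝ ℂ) (fun _ => le_rfl)
    simp only [add_zero] at h2
    exact h1.mul h2 hshift (fun _ => hconj)
  obtain ⟨R, hR⟩ := hχc.isCompact.isBounded.subset_closedBall 0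
  have hz : ∀ x, R < ‖x‖ → χ x = 0 := fun x hx => by
    by_contra h
    have := hR (subset_tsupport χ h)
    simp at this
    linarith
  have hbR : ∀ h x, R < ‖x‖ → b h x = 0 := fun h x hx => by simp [b, hz x hx]
  obtain ⟨C₀, hC₀⟩ := exists_norm_integral_exp_mul_le (μ := volume) hg hg' hc hgc 0 hb hb' hbR
  obtain ⟨C₁, hC₁⟩ :=
    exists_norm_integral_exp_mul_le (μ := volume) hg hg' hc hgc (d + 1) hb hb' hbR
  set M : ℝ := 2 ^ (d + 1) * max C₀ C₁ with hM
  set S : ℝ := ∫ h : E, (1 + ‖h‖) ^ (-((d : ℝ) + 1))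
  have hSint : Integrable fun h : E => (1 + ‖h‖) ^ (-((d : ℝ) + 1)) :=
    integrable_one_add_norm (by rw [← hd]; linarith)
  -- decay for `t` away from zero
  have hlarge : ∀ (t : ℝ) (y : E), t ≠ 0 →
      ‖∫ ξ, Complex.exp ((t * Φ ξ + inner ℝ y ξ : ℝ) * Complex.I) * χ ξ‖ ^ 2 ≤
        M * (|t|⁻¹ ^ d * S) := by
    intro t y ht
    have ht0 : 0 < |t| := abs_pos.2 ht
    set f : E → ℂ := fun ξ => Complex.exp ((t * Φ ξ + inner ℝ y ξ : ℝ) * Complex.I) * χ ξ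
    have hfc : Continuous f := by
      have := hΦ.continuous
      have := hχ.continuous
      fun_prop
    have hfs : HasCompactSupport f := hχc.mul_left
    have hJ : ∀ h : ι, ‖∫ η, f (η + h) * (starRingEnd ℂ) (f η)‖ ≤
        M * (1 + ‖|t| • (h : E)‖) ^ (-((d : ℝ) + 1)) := by
      intro h
      let θ : E → ℝ := fun η => t * (Φ (η + h) - Φ η) + inner ℝ y (h : E)
      have hθ : ContDiff ℝ ∞ θ :=
        (contDiff_const.mul ((hΦ.comp (contDiff_id.add contDiff_const)).sub hΦ)).add contDiff_const
      have hl : t * ‖(h : E)‖ ≠ 0 := mul_ne_zero ht (hpos h).ne'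
      have hθg : ∀ x, (fderiv ℝ θ x (e h) : ℂ) = (t * ‖(h : E)‖ : ℝ) * g h x := by
        intro x
        have h1 : HasFDerivAt θ (t • (fderiv ℝ Φ (x + h) - fderiv ℝ Φ x)) x :=
          ((((hasFDerivAt_comp_add_right (h : E)).2
            (hΦ.differentiable_of_infty (x + h)).hasFDerivAt).sub
            (hΦ.differentiable_of_infty x).hasFDerivAt).const_mul t).add_const _
        rw [h1.fderiv]
        push_cast
        rw [mul_assoc, ← hg_eq]
        simp
      have hfe : ∀ η, f (η + h) * (starRingEnd ℂ) (f η) =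
          Complex.exp (θ η * Complex.I) * b h η := by
        intro η
        simp only [f, b, θ, map_mul, ← Complex.exp_conj, Complex.conj_ofReal, Complex.conj_I]
        rw [mul_mul_mul_comm, ← Complex.exp_add]
        congr 2
        rw [inner_add_right]
        push_cast
        ring
      simp only [hfe]
      have h0 := hC₀ h _ hl θ hθ hθg
      have h1 := hC₁ h _ hl θ hθ hθg
      set s := |t * ‖(h : E)‖| with hs
      have hs0 : 0 < s := abs_pos.2 hl
      have hst : ‖|t| • (h : E)‖ = s := by
        rw [norm_smul, hs, abs_mul, abs_norm, Real.norm_eq_abs, abs_abs]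
      rw [hst, Real.rpow_neg (by positivity)]
      rw [show (d : ℝ) + 1 = ((d + 1 : ℕ) : ℝ) by push_cast; ring, Real.rpow_natCast,
        ← div_eq_mul_inv, le_div_iff₀ (by positivity)]
      set J := ‖∫ η, Complex.exp (θ η * Complex.I) * b h η‖
      have hJ0 : 0 ≤ J := norm_nonneg _
      rw [pow_zero, div_one] at h0
      rw [le_div_iff₀ (by positivity)] at h1
      rcases le_total s 1 with hs1 | hs1
      · calc J * (1 + s) ^ (d + 1) ≤ C₀ * 2 ^ (d + 1) := by
              have : 0 ≤ C₀ := hJ0.trans h0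
              gcongr
              linarith
          _ ≤ M := by
              rw [hM, mul_comm]
              gcongr
              exact le_max_left _ _
      · calc J * (1 + s) ^ (d + 1) ≤ J * (2 * s) ^ (d + 1) := by
              gcongr
              linarith
          _ = 2 ^ (d + 1) * (J * s ^ (d + 1)) := by rw [mul_pow]; ring
          _ ≤ M := by
              rw [hM]
              gcongr
              exact h1.trans (le_max_right _ _)
    have h1 : ‖∫ ξ, f ξ‖ ^ 2 = ‖∫ h, ∫ η, f (η + h) * (starRingEnd ℂ) (f η)‖ := by
      rw [← integral_mul_conj_integral hfc hfs, norm_mul, RCLike.norm_conj, sq]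
    rw [h1]
    refine (norm_integral_le_of_norm_le ((hSint.comp_smul ht0.ne').const_mul M) ?_).trans ?_
    · have : ∀ᵐ h : E, h ≠ 0 := by
        rw [ae_iff]
        simp
      filter_upwards [this] with h hh
      exact hJ ⟨h, hh⟩
    · rw [integral_const_mul,
        Measure.integral_comp_smul volume (fun h : E => (1 + ‖h‖) ^ (-((d : ℝ) + 1))) |t|,
        ← hd, abs_of_nonneg (by positivity), smul_eq_mul, inv_pow]
  have hχi : Integrable χ := hχ.continuous.integrable_of_hasCompactSupport hχc
  have hS0 : 0 ≤ S := integral_nonneg fun h => by positivity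
  refine ⟨2 ^ ((d : ℝ) / 2) * max (∫ ξ, ‖χ ξ‖) (Real.sqrt (M * S)), fun t y => ?_⟩
  set I := ‖∫ ξ, Complex.exp ((t * Φ ξ + inner ℝ y ξ : ℝ) * Complex.I) * χ ξ‖
  have hI0 : 0 ≤ I := norm_nonneg _
  rw [Real.rpow_neg (by positivity), ← div_eq_mul_inv, le_div_iff₀ (by positivity)]
  have hIt : I ≤ ∫ ξ, ‖χ ξ‖ := by
    refine (norm_integral_le_integral_norm _).trans (le_of_eq ?_)
    simp only [norm_mul, Complex.norm_exp_ofReal_mul_I, one_mul]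
  rcases le_total |t| 1 with ht | ht
  · rw [mul_comm]
    have : (1 + |t|) ^ ((d : ℝ) / 2) ≤ 2 ^ ((d : ℝ) / 2) := by
      gcongr
      linarith
    exact mul_le_mul this (hIt.trans (le_max_left _ _)) hI0 (by positivity)
  · have ht0 : 0 < |t| := by linarith
    have h2 : (1 + |t|) ^ ((d : ℝ) / 2) ≤ 2 ^ ((d : ℝ) / 2) * |t| ^ ((d : ℝ) / 2) := by
      rw [← Real.mul_rpow (by norm_num) (abs_nonneg _)]
      gcongr
      linarith
    have h3 : I * |t| ^ ((d : ℝ) / 2) ≤ Real.sqrt (M * S) := by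
      refine Real.le_sqrt_of_sq_le ?_
      have h4 := hlarge t y (abs_pos.1 ht0)
      have h5 : (|t| ^ ((d : ℝ) / 2)) ^ 2 = |t| ^ d := by
        rw [← Real.rpow_natCast, ← Real.rpow_mul ht0.le, ← Real.rpow_natCast]
        congr 1
        push_cast
        ring
      rw [mul_pow, h5]
      calc I ^ 2 * |t| ^ d ≤ M * (|t|⁻¹ ^ d * S) * |t| ^ d := by gcongr
        _ = M * S := by
          rw [inv_pow]
          field_simp
    calc I * (1 + |t|) ^ ((d : ℝ) / 2)
        ≤ I * (2 ^ ((d : ℝ) / 2) * |t| ^ ((d : ℝ) / 2)) := by gcongr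
      _ = 2 ^ ((d : ℝ) / 2) * (I * |t| ^ ((d : ℝ) / 2)) := by ring
      _ ≤ _ := by
        gcongr
        exact h3.trans (le_max_right _ _)

/-- The dispersive estimate for `e^{it(-Δ)^{α/2}}` at unit frequency. -/
theorem exists_norm_fourierInv_propagator_le [Nontrivial E] {α : ℝ} (hα : 2 < α) {χ : E → ℂ}
    (hχ : ContDiff ℝ ∞ χ) (hχs : ∀ ξ, χ ξ ≠ 0 → 1 / 2 ≤ ‖ξ‖ ∧ ‖ξ‖ ≤ 4) :
    ∃ C : ℝ, ∀ (t : ℝ) (x : E),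
      ‖𝓕⁻ (fun ξ => Complex.exp ((t * ‖ξ‖ ^ α : ℝ) * Complex.I) * χ ξ) x‖ ≤
        C * (1 + |t|) ^ (-((Module.finrank ℝ E : ℝ) / 2)) := by
  obtain ⟨Φ, X, k, c, hc, hΦ, hX, hXc, hgrad, hmono, hΦeq⟩ := exists_global_phase (E := E) hα
  have hχc : HasCompactSupport χ := by
    refine HasCompactSupport.intro (isCompact_closedBall (0 : E) 4) fun ξ hξ => ?_
    by_contra h
    exact hξ (by simpa using (hχs ξ h).2)
  obtain ⟨C, hC⟩ := exists_norm_oscillatory_integral_le hΦ hX hXc hc hgrad hmono hχ hχc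
  refine ⟨C, fun t x => ?_⟩
  convert! hC t ((2 * Real.pi) • x) using 2
  rw [Real.fourierInv_eq']
  congr 1
  ext ξ
  by_cases h : χ ξ = 0
  · simp [h]
  · obtain ⟨h1, h2⟩ := hχs ξ h
    rw [hΦeq ξ h1 h2, smul_eq_mul, ← mul_assoc, ← Complex.exp_add, real_inner_smul_left,
      real_inner_comm]
    congr 2
    push_cast
    ring

end Dispersive

/-! ### The sesquilinear form of a Fourier multiplier -/

section FixedTime

variable {E : Type*} [NormedAddCommGroup E] [InnerProductSpace ℝ E] [FiniteDimensional ℝ E]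
  [MeasurableSpace E] [BorelSpace E]

lemma memLp_two_mul_fourier {a F : E → ℂ} {K : ℝ} (ha : AEStronglyMeasurable a volume)
    (haK : ∀ ξ, ‖a ξ‖ ≤ K) (hF1 : Integrable F) (hF2 : MemLp F 2) :
    MemLp (fun ξ => a ξ * 𝓕 F ξ) 2 := by
  have h1 : MemLp (𝓕 F) 2 :=
    ⟨(continuous_fourier hF1).aestronglyMeasurable, by
      rw [eLpNorm_fourier hF1 hF2]; exact hF2.2⟩
  refine h1.of_le_mul (c := K) (ha.mul h1.1) (Filter.Eventually.of_forall fun ξ => ?_)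
  rw [norm_mul]
  exact mul_le_mul_of_nonneg_right (haK ξ) (norm_nonneg _)

lemma integrable_mul_fourier {a F : E → ℂ} (ha : Integrable a) (hF1 : Integrable F) :
    Integrable (fun ξ => a ξ * 𝓕 F ξ) :=
  ha.mul_bdd (c := ∫ x, ‖F x‖) (continuous_fourier hF1).aestronglyMeasurable
    (Filter.Eventually.of_forall (norm_fourier_le F))

/-- A Fourier multiplier whose kernel `𝓕⁻ a` is bounded by `B` maps `L¹` to `L^∞`. -/
lemma norm_fourierInv_mul_fourier_le {a F : E → ℂ} {B : ℝ} (ha : Integrable a)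
    (hB : ∀ x, ‖𝓕⁻ a x‖ ≤ B) (hF1 : Integrable F) (x : E) :
    ‖𝓕⁻ (fun ξ => a ξ * 𝓕 F ξ) x‖ ≤ B * ∫ y, ‖F y‖ := by
  let b : E → ℂ := fun ξ => Complex.exp (((2 * Real.pi * inner ℝ ξ x : ℝ) : ℂ) * Complex.I) * a ξ
  have hb : Integrable b :=
    ha.bdd_mul (c := 1) (by fun_prop) (Filter.Eventually.of_forall fun ξ => by
      rw [Complex.norm_exp_ofReal_mul_I])
  have hker : ∀ y, 𝓕 b y = 𝓕⁻ a (x - y) := by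
    intro y
    rw [Real.fourier_eq', Real.fourierInv_eq']
    congr 1
    ext ξ
    simp only [b, smul_eq_mul]
    rw [← mul_assoc, ← Complex.exp_add]
    congr 2
    rw [inner_sub_right]
    push_cast
    ring
  have h1 : 𝓕⁻ (fun ξ => a ξ * 𝓕 F ξ) x = ∫ y, F y * 𝓕⁻ a (x - y) := by
    simp only [← hker]
    rw [← integral_fourier_mul_eq hF1 hb, Real.fourierInv_eq']
    congr 1
    ext ξ
    simp only [b, smul_eq_mul]
    ring
  rw [h1, ← integral_const_mul]
  refine norm_integral_le_of_norm_le (hF1.norm.const_mul B)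
    (Filter.Eventually.of_forall fun y => ?_)
  rw [norm_mul, mul_comm]
  exact mul_le_mul_of_nonneg_right (hB _) (norm_nonneg _)

/-- The interpolated bound, in `L^{r'}`, for the sesquilinear form of a Fourier multiplier with
bounded symbol and bounded kernel. -/
theorem norm_integral_mul_fourier_conj_fourier_le {r K : ℝ} (hr : 2 < r) (hK : 0 ≤ K) :
    ∃ c : ℝ, 0 ≤ c ∧ ∀ (a : E → ℂ) (B : ℝ), Integrable a → (∀ ξ, ‖a ξ‖ ≤ K) → 0 < B →
      (∀ x, ‖𝓕⁻ a x‖ ≤ B) → ∀ F G : E → ℂ, Measurable F → Integrable F → MemLp F 2 →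
      Integrable G → MemLp G 2 →
      MemLp F (ENNReal.ofReal (r / (r - 1))) → MemLp G (ENNReal.ofReal (r / (r - 1))) →
      ‖∫ ξ, a ξ * 𝓕 F ξ * (starRingEnd ℂ) (𝓕 G ξ)‖ ≤
        c * B ^ (1 - 2 / r) * (∫ x, ‖F x‖ ^ (r / (r - 1))) ^ (1 - 1 / r) *
          (∫ x, ‖G x‖ ^ (r / (r - 1))) ^ (1 - 1 / r) := by
  set p := r / (r - 1) with hp
  have hr0 : 0 < r := by linarith
  have hr1 : 0 < r - 1 := by linarith
  have hr2 : 0 < r - 2 := by linarith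
  have hp0 : 0 < p := by positivity
  have hpr : 1 / p = 1 - 1 / r := by rw [hp]; field_simp
  have hconj : r.HolderConjugate p := Real.HolderConjugate.conjExponent (by linarith)
  refine ⟨(4 * r / (r - 2) * 2 ^ (r - 2) * K ^ 2) ^ (1 / r), by positivity, ?_⟩
  intro a B ha haK hB hker F G hFm hF1 hF2 hG1 hG2 hFp hGp
  set T : (E → ℂ) → E → ℂ := fun F => 𝓕⁻ (fun ξ => a ξ * 𝓕 F ξ) with hT
  set NF := ∫ x, ‖F x‖ ^ p with hNF
  have hNF0 : 0 ≤ NF := integral_nonneg fun x => by positivity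
  have htoReal : ∀ s : ℝ, 0 < s → (ENNReal.ofReal s).toReal = s := fun s hs =>
    ENNReal.toReal_ofReal hs.le
  have hFint : Integrable (fun x => ‖F x‖ ^ p) := by
    have := hFp.integrable_norm_rpow (by simpa using hp0) ENNReal.ofReal_ne_top
    rwa [htoReal p hp0] at this
  have hinterp := lintegral_rpow_le_of_L1_Linfty_of_L2 (μ := (volume : Measure E))
    (ν := (volume : Measure E)) T (A := ENNReal.ofReal (K ^ 2)) hB hr ?_ ?_ ?_ ?_ hFm hF1 hF2
  rotate_left
  · intro f g _ hf1 _ _ hg1 _ y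
    have h1 : 𝓕 (f + g) = 𝓕 f + 𝓕 g := by
      ext ξ
      simp only [Pi.add_apply, Real.fourier_eq, smul_add]
      exact integral_add ((Real.fourierIntegral_convergent_iff _).2 hf1)
        ((Real.fourierIntegral_convergent_iff _).2 hg1)
    have h2 : ∀ h : E → ℂ, Integrable h →
        Integrable (fun ξ => Real.fourierChar (inner ℝ ξ y) • (a ξ * 𝓕 h ξ)) := by
      intro h hh
      have := (Real.fourierIntegral_convergent_iff (-y)).2 (integrable_mul_fourier ha hh)
      simpa using this
    simp only [hT, Real.fourierInv_eq, h1, Pi.add_apply, mul_add, smul_add]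
    exact integral_add (h2 f hf1) (h2 g hg1)
  · intro f _ hf1 _
    exact (continuous_fourierInv (integrable_mul_fourier ha hf1)).measurable.aemeasurable
  · intro f _ hf1 _ y
    rw [← ofReal_norm]
    refine (ENNReal.ofReal_le_ofReal (norm_fourierInv_mul_fourier_le ha hker hf1 y)).trans ?_
    rw [ENNReal.ofReal_mul hB.le, ofReal_integral_norm_eq_lintegral_enorm hf1]
  · intro f _ hf1 hf2
    have h1 : ∀ h : E → ℂ, ∫⁻ y, ‖h y‖ₑ ^ 2 = eLpNorm h 2 volume ^ 2 := by
      intro h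
      rw [eLpNorm_eq_lintegral_rpow_enorm_toReal (by norm_num) (by norm_num),
        ← ENNReal.rpow_natCast, ← ENNReal.rpow_mul]
      simp
    have h2 := memLp_two_mul_fourier ha.1 haK hf1 hf2
    rw [h1, h1, hT]
    simp only
    rw [eLpNorm_fourierInv (integrable_mul_fourier ha hf1) h2, ← eLpNorm_fourier hf1 hf2,
      ENNReal.ofReal_pow hK, ← mul_pow]
    gcongr
    exact eLpNorm_le_mul_eLpNorm_of_ae_le_mul (Filter.Eventually.of_forall fun ξ => by
      rw [norm_mul]
      exact mul_le_mul_of_nonneg_right (haK ξ) (norm_nonneg _)) 2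
  rw [← hp, ← ofReal_integral_eq_lintegral_ofReal hFint
      (Filter.Eventually.of_forall fun x => by positivity), ← hNF,
    ENNReal.ofReal_rpow_of_nonneg hNF0 hr1.le, ← ENNReal.ofReal_mul (by positivity),
    ← ENNReal.ofReal_mul (by positivity)] at hinterp
  have hTc : Continuous (T F) := continuous_fourierInv (integrable_mul_fourier ha hF1)
  have hTint : Integrable (fun x => ‖T F x‖ ^ r) := by
    refine ⟨(hTc.norm.rpow_const fun _ => Or.inr hr0.le).aestronglyMeasurable, ?_⟩
    rw [hasFiniteIntegral_iff_ofReal (Filter.Eventually.of_forall fun x => by positivity)]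
    exact hinterp.trans_lt ENNReal.ofReal_lt_top
  have hTr : MemLp (T F) (ENNReal.ofReal r) := by
    rw [← integrable_norm_rpow_iff hTc.aestronglyMeasurable (by simpa using hr0)
      ENNReal.ofReal_ne_top, htoReal r hr0]
    exact hTint
  have hbound : ∫ x, ‖T F x‖ ^ r ≤ 4 * r / (r - 2) * (2 * B) ^ (r - 2) * K ^ 2 * NF ^ (r - 1) := by
    rw [← ofReal_integral_eq_lintegral_ofReal hTint
      (Filter.Eventually.of_forall fun x => by positivity)] at hinterp
    exact (ENNReal.ofReal_le_ofReal_iff (by positivity)).1 hinterp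
  have hpair : ∫ ξ, a ξ * 𝓕 F ξ * (starRingEnd ℂ) (𝓕 G ξ) =
      ∫ x, T F x * (starRingEnd ℂ) (G x) :=
    (integral_fourierInv_mul_conj (integrable_mul_fourier ha hF1) hG1).symm
  rw [hpair]
  refine (norm_integral_le_integral_norm _).trans ?_
  simp only [norm_mul, RCLike.norm_conj]
  refine (integral_mul_norm_le_Lp_mul_Lq hconj hTr hGp).trans ?_
  rw [hpr]
  gcongr
  calc (∫ x, ‖T F x‖ ^ r) ^ (1 / r)
      ≤ (4 * r / (r - 2) * (2 * B) ^ (r - 2) * K ^ 2 * NF ^ (r - 1)) ^ (1 / r) := by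
        refine Real.rpow_le_rpow (integral_nonneg fun x => by positivity) hbound (by positivity)
    _ = ((4 * r / (r - 2) * 2 ^ (r - 2) * K ^ 2) * B ^ (r - 2) * NF ^ (r - 1)) ^ (1 / r) := by
        rw [Real.mul_rpow (by norm_num) hB.le]
        ring_nf
    _ = _ := by
        rw [Real.mul_rpow (by positivity) (by positivity), Real.mul_rpow (by positivity)
          (by positivity), ← Real.rpow_mul hB.le, ← Real.rpow_mul hNF0]
        congr 3
        · field_simp
        · field_simp

end FixedTime

/-! ### Young's inequality on `ℤ` -/

section DiscreteYoung

/-- Young's inequality for the bilinear form `∑ k (n - m) a n a m`. -/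
lemma sum_sum_mul_le_of_summable {q : ℝ} (hq : 2 < q) {k : ℤ → ℝ} (hk0 : ∀ n, 0 < k n)
    (hk : Summable fun n => k n ^ (q / 2)) (S : Finset ℤ) {a : ℤ → ℝ} (ha : ∀ n, 0 ≤ a n) :
    ∑ n ∈ S, ∑ m ∈ S, k (n - m) * (a n * a m) ≤
      (∑' n, k n ^ (q / 2)) ^ (2 / q) * (∑ n ∈ S, a n ^ (q / (q - 1))) ^ (2 - 2 / q) := by
  set p := q / (q - 1) with hp
  set κ := ∑' n, k n ^ (q / 2) with hκ
  set A := ∑ n ∈ S, a n ^ p with hA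
  have hq0 : 0 < q := by linarith
  have hq1 : 0 < q - 1 := by linarith
  have hp0 : 0 < p := by positivity
  have hκ0 : 0 < κ := hk.tsum_pos (fun n => (Real.rpow_pos_of_pos (hk0 n) _).le) 0
    (Real.rpow_pos_of_pos (hk0 0) _)
  have hap : ∀ n, 0 ≤ a n ^ p := fun n => Real.rpow_nonneg (ha n) _
  have hks : ∀ n, 0 ≤ k n ^ (q / 2) := fun n => (Real.rpow_pos_of_pos (hk0 n) _).le
  have hA0 : 0 ≤ A := Finset.sum_nonneg fun n _ => hap n
  rcases hA0.eq_or_lt with hAz | hApos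
  · have hz : ∀ n ∈ S, a n = 0 := by
      intro n hn
      have h1 := (Finset.sum_eq_zero_iff_of_nonneg fun n _ => hap n).1 hAz.symm n hn
      exact ((Real.rpow_eq_zero_iff_of_nonneg (ha n)).1 h1).1
    have h2 : ∑ n ∈ S, ∑ m ∈ S, k (n - m) * (a n * a m) = 0 :=
      Finset.sum_eq_zero fun n hn => Finset.sum_eq_zero fun m hm => by simp [hz n hn]
    rw [h2]
    positivity
  -- the weighted arithmetic-geometric mean inequality for the normalized factors
  have hterm : ∀ n m, k (n - m) * (a n * a m) ≤ κ ^ (2 / q) * A ^ (2 - 2 / q) *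
      (1 / q * (a n ^ p * k (n - m) ^ (q / 2) / (A * κ)) +
        1 / q * (a m ^ p * k (n - m) ^ (q / 2) / (A * κ)) +
        (1 - 2 / q) * (a n ^ p * a m ^ p / (A * A))) := by
    intro n m
    have hx := ha n
    have hy := ha m
    have hz := (hk0 (n - m)).le
    set x := a n
    set y := a m
    set z := k (n - m)
    have h1q : 0 ≤ 1 - 2 / q := by
      rw [sub_nonneg, div_le_one hq0]; exact hq.le
    have hamgm := Real.geom_mean_le_arith_mean3_weighted (w₁ := 1 / q) (w₂ := 1 / q)
      (w₃ := 1 - 2 / q) (p₁ := x ^ p * z ^ (q / 2) / (A * κ)) (p₂ := y ^ p * z ^ (q / 2) / (A * κ))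
      (p₃ := x ^ p * y ^ p / (A * A)) (by positivity) (by positivity) h1q (by positivity)
      (by positivity) (by positivity) (by ring)
    refine le_trans (le_of_eq ?_) (mul_le_mul_of_nonneg_left hamgm (by positivity))
    have e1 : p * (1 / q) + p * (1 - 2 / q) = 1 := by rw [hp]; field_simp; ring
    have e2 : q / 2 * (1 / q) + q / 2 * (1 / q) = 1 := by field_simp; norm_num
    have e3 : κ ^ (2 / q) = κ ^ (1 / q) * κ ^ (1 / q) := by
      rw [← Real.rpow_add hκ0]; congr 1; ring
    have e4 : A ^ (2 - 2 / q) =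
        A ^ (1 / q) * A ^ (1 / q) * (A ^ (1 - 2 / q) * A ^ (1 - 2 / q)) := by
      rw [← Real.rpow_add hApos, ← Real.rpow_add hApos, ← Real.rpow_add hApos]; congr 1; ring
    have hsplit : ∀ {v : ℝ}, 0 ≤ v → v = v ^ (p * (1 / q)) * v ^ (p * (1 - 2 / q)) := by
      intro v hv
      rw [← Real.rpow_add_of_nonneg hv (by positivity) (mul_nonneg hp0.le h1q), e1, Real.rpow_one]
    have hsplitz : z = z ^ (q / 2 * (1 / q)) * z ^ (q / 2 * (1 / q)) := by
      rw [← Real.rpow_add_of_nonneg hz (by positivity) (by positivity), e2, Real.rpow_one]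
    rw [e3, e4]
    simp only [Real.div_rpow (mul_nonneg (Real.rpow_nonneg hx p) (Real.rpow_nonneg hz (q / 2)))
        (mul_nonneg hA0 hκ0.le),
      Real.div_rpow (mul_nonneg (Real.rpow_nonneg hy p) (Real.rpow_nonneg hz (q / 2)))
        (mul_nonneg hA0 hκ0.le),
      Real.div_rpow (mul_nonneg (Real.rpow_nonneg hx p) (Real.rpow_nonneg hy p))
        (mul_nonneg hA0 hA0),
      Real.mul_rpow (Real.rpow_nonneg hx p) (Real.rpow_nonneg hz (q / 2)),
      Real.mul_rpow (Real.rpow_nonneg hy p) (Real.rpow_nonneg hz (q / 2)),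
      Real.mul_rpow (Real.rpow_nonneg hx p) (Real.rpow_nonneg hy p),
      Real.mul_rpow hA0 hκ0.le, Real.mul_rpow hA0 hA0, ← Real.rpow_mul hx, ← Real.rpow_mul hy,
      ← Real.rpow_mul hz]
    conv_lhs => rw [hsplit hx, hsplit hy, hsplitz]
    have hA1 : A ^ (1 / q) ≠ 0 := (Real.rpow_pos_of_pos hApos _).ne'
    have hA2 : A ^ (1 - 2 / q) ≠ 0 := (Real.rpow_pos_of_pos hApos _).ne'
    have hκ1 : κ ^ (1 / q) ≠ 0 := (Real.rpow_pos_of_pos hκ0 _).ne'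
    generalize A ^ (1 / q) = A1 at *
    generalize A ^ (1 - 2 / q) = A2 at *
    generalize κ ^ (1 / q) = κ1 at *
    field_simp
  have hcol : ∀ n, ∑ m ∈ S, k (n - m) ^ (q / 2) ≤ κ := by
    intro n
    have := ((Equiv.subLeft n).summable_iff (f := fun j => k j ^ (q / 2))).2 hk
    refine (this.sum_le_tsum S fun m _ => hks _).trans (le_of_eq ?_)
    exact (Equiv.subLeft n).tsum_eq fun j => k j ^ (q / 2)
  have hrow : ∀ m, ∑ n ∈ S, k (n - m) ^ (q / 2) ≤ κ := by
    intro m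
    have := ((Equiv.subRight m).summable_iff (f := fun j => k j ^ (q / 2))).2 hk
    refine (this.sum_le_tsum S fun n _ => hks _).trans (le_of_eq ?_)
    exact (Equiv.subRight m).tsum_eq fun j => k j ^ (q / 2)
  have h1 : ∑ n ∈ S, ∑ m ∈ S, a n ^ p * k (n - m) ^ (q / 2) ≤ A * κ := by
    simp only [← Finset.mul_sum]
    rw [hA, Finset.sum_mul]
    exact Finset.sum_le_sum fun n _ => mul_le_mul_of_nonneg_left (hcol n) (hap n)
  have h2 : ∑ n ∈ S, ∑ m ∈ S, a m ^ p * k (n - m) ^ (q / 2) ≤ A * κ := by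
    rw [Finset.sum_comm]
    simp only [← Finset.mul_sum]
    rw [hA, Finset.sum_mul]
    exact Finset.sum_le_sum fun n _ => mul_le_mul_of_nonneg_left (hrow n) (hap n)
  have h3 : ∑ n ∈ S, ∑ m ∈ S, a n ^ p * a m ^ p = A * A := by
    rw [hA, Finset.sum_mul_sum]
  calc ∑ n ∈ S, ∑ m ∈ S, k (n - m) * (a n * a m)
      ≤ ∑ n ∈ S, ∑ m ∈ S, κ ^ (2 / q) * A ^ (2 - 2 / q) *
      (1 / q * (a n ^ p * k (n - m) ^ (q / 2) / (A * κ)) +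
        1 / q * (a m ^ p * k (n - m) ^ (q / 2) / (A * κ)) +
        (1 - 2 / q) * (a n ^ p * a m ^ p / (A * A))) :=
        Finset.sum_le_sum fun n _ => Finset.sum_le_sum fun m _ => hterm n m
    _ = κ ^ (2 / q) * A ^ (2 - 2 / q) *
        (1 / q * ((∑ n ∈ S, ∑ m ∈ S, a n ^ p * k (n - m) ^ (q / 2)) / (A * κ)) +
        1 / q * ((∑ n ∈ S, ∑ m ∈ S, a m ^ p * k (n - m) ^ (q / 2)) / (A * κ)) +
        (1 - 2 / q) * ((∑ n ∈ S, ∑ m ∈ S, a n ^ p * a m ^ p) / (A * A))) := by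
        simp only [Finset.sum_div, Finset.mul_sum, Finset.sum_add_distrib, mul_add]
    _ ≤ κ ^ (2 / q) * A ^ (2 - 2 / q) * (1 / q * 1 + 1 / q * 1 + (1 - 2 / q) * 1) := by
        have h1q : 0 ≤ 1 - 2 / q := by
          rw [sub_nonneg, div_le_one hq0]; exact hq.le
        gcongr
        · exact div_le_one_of_le₀ h1 (by positivity)
        · exact div_le_one_of_le₀ h2 (by positivity)
        · rw [h3]; exact div_le_one_of_le₀ le_rfl (by positivity)
    _ = _ := by ring

end DiscreteYoung

/-! ### Strichartz estimates along integer times -/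

section DiscreteStrichartz

variable {E : Type*} [NormedAddCommGroup E] [InnerProductSpace ℝ E] [FiniteDimensional ℝ E]
  [MeasurableSpace E] [BorelSpace E]

/-- The frequency-localized propagator on the Fourier side: the inverse Fourier transform of
`e^{i t p(ξ)} χ(ξ) φ(ξ)`. -/
noncomputable def freqEvol (p : E → ℝ) (χ φ : E → ℂ) (t : ℝ) : E → ℂ :=
  𝓕⁻ (fun ξ => Complex.exp ((t * p ξ : ℝ) * Complex.I) * (χ ξ * φ ξ))

variable {p : E → ℝ} {χ : E → ℂ}

lemma integrable_exp_mul {f : E → ℂ} (hp : Continuous p) (hf : Integrable f) (t : ℝ) :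
    Integrable (fun ξ => Complex.exp ((t * p ξ : ℝ) * Complex.I) * f ξ) :=
  hf.bdd_mul (c := 1) (by fun_prop) (Filter.Eventually.of_forall fun ξ => by
    rw [Complex.norm_exp_ofReal_mul_I])

lemma integrable_cutoff_mul (hχ : Continuous χ) (hχc : HasCompactSupport χ) {φ : E → ℂ}
    (hφ : MemLp φ 2) : Integrable (fun ξ => χ ξ * φ ξ) :=
  MemLp.integrable_mul (p := 2) (q := 2) (hχ.memLp_of_hasCompactSupport hχc) hφ

lemma continuous_freqEvol (hp : Continuous p) (hχ : Continuous χ) (hχc : HasCompactSupport χ)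
    {φ : E → ℂ} (hφ : MemLp φ 2) (t : ℝ) : Continuous (freqEvol p χ φ t) :=
  continuous_fourierInv (integrable_exp_mul hp (integrable_cutoff_mul hχ hχc hφ) t)

/-- The `TT*` argument: a sum of pairings of the evolution with test functions is controlled by the
sesquilinear forms of the multipliers `e^{i(m - n)p} |χ|²`. -/
lemma norm_sum_integral_freqEvol_le (hp : Continuous p) (hχ : Continuous χ)
    (hχc : HasCompactSupport χ) {φ : E → ℂ} (hφ : MemLp φ 2) (S : Finset ℤ) {H : ℤ → E → ℂ}
    (hH : ∀ n, Integrable (H n)) :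
    ‖∑ n ∈ S, ∫ x, freqEvol p χ φ n x * (starRingEnd ℂ) (H n x)‖ ≤
      (∫ ξ, ‖φ ξ‖ ^ (2 : ℝ)) ^ (1 / 2 : ℝ) *
      (∑ n ∈ S, ∑ m ∈ S, ‖∫ ξ, Complex.exp ((((m - n : ℤ) : ℝ) * p ξ : ℝ) * Complex.I) *
        (χ ξ * (starRingEnd ℂ) (χ ξ)) * 𝓕 (H n) ξ * (starRingEnd ℂ) (𝓕 (H m) ξ)‖) ^
          (1 / 2 : ℝ) := by
  let w : ℤ → E → ℂ := fun n ξ => Complex.exp (((n : ℝ) * p ξ : ℝ) * Complex.I)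
  have hwc : ∀ n, Continuous (w n) := fun n => by fun_prop
  have hFc : ∀ n, Continuous (𝓕 (H n)) := fun n => continuous_fourier (hH n)
  let V : E → ℂ := fun ξ => ∑ n ∈ S, (starRingEnd ℂ) (w n ξ * χ ξ) * 𝓕 (H n) ξ
  have hVn : ∀ n, Continuous fun ξ => (starRingEnd ℂ) (w n ξ * χ ξ) * 𝓕 (H n) ξ := fun n =>
    (Complex.continuous_conj.comp ((hwc n).mul hχ)).mul (hFc n)
  have hVc : Continuous V := continuous_finsetSum _ fun n _ => hVn n
  have hVs : HasCompactSupport V := by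
    refine HasCompactSupport.intro hχc fun ξ hξ => Finset.sum_eq_zero fun n _ => ?_
    rw [image_eq_zero_of_notMem_tsupport hξ]
    simp
  have hVL : MemLp V 2 := hVc.memLp_of_hasCompactSupport hVs
  have h1 : ∑ n ∈ S, ∫ x, freqEvol p χ φ n x * (starRingEnd ℂ) (H n x) =
      ∫ ξ, φ ξ * (starRingEnd ℂ) (V ξ) := by
    have hi : ∀ n ∈ S, Integrable fun ξ =>
        φ ξ * (starRingEnd ℂ) ((starRingEnd ℂ) (w n ξ * χ ξ) * 𝓕 (H n) ξ) := fun n _ => by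
      refine MemLp.integrable_mul (p := 2) (q := 2) hφ (Continuous.memLp_of_hasCompactSupport
        (Complex.continuous_conj.comp (hVn n)) (HasCompactSupport.intro hχc fun ξ hξ => ?_))
      simp [image_eq_zero_of_notMem_tsupport hξ]
    simp only [V, map_sum, Finset.mul_sum]
    rw [integral_finsetSum _ hi]
    refine Finset.sum_congr rfl fun n _ => ?_
    rw [freqEvol, integral_fourierInv_mul_conj (integrable_exp_mul hp
      (integrable_cutoff_mul hχ hχc hφ) n) (hH n)]
    congr 1
    ext ξ
    simp only [w, map_mul, Complex.conj_conj]
    ring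
  rw [h1]
  refine (norm_integral_le_integral_norm _).trans ?_
  simp only [norm_mul, RCLike.norm_conj]
  refine (integral_mul_norm_le_Lp_mul_Lq Real.HolderConjugate.two_two (by simpa using hφ)
    (by simpa using hVL)).trans ?_
  have h2 : ∫ ξ, ‖V ξ‖ ^ (2 : ℝ) ≤ ∑ n ∈ S, ∑ m ∈ S,
      ‖∫ ξ, Complex.exp ((((m - n : ℤ) : ℝ) * p ξ : ℝ) * Complex.I) *
        (χ ξ * (starRingEnd ℂ) (χ ξ)) * 𝓕 (H n) ξ * (starRingEnd ℂ) (𝓕 (H m) ξ)‖ := by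
    have h3 : ((∫ ξ, ‖V ξ‖ ^ (2 : ℝ) : ℝ) : ℂ) = ∑ n ∈ S, ∑ m ∈ S,
        ∫ ξ, Complex.exp ((((m - n : ℤ) : ℝ) * p ξ : ℝ) * Complex.I) *
        (χ ξ * (starRingEnd ℂ) (χ ξ)) * 𝓕 (H n) ξ * (starRingEnd ℂ) (𝓕 (H m) ξ) := by
      have h4 : ∀ ξ, ((‖V ξ‖ ^ (2 : ℝ) : ℝ) : ℂ) = ∑ n ∈ S, ∑ m ∈ S,
          Complex.exp ((((m - n : ℤ) : ℝ) * p ξ : ℝ) * Complex.I) *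
          (χ ξ * (starRingEnd ℂ) (χ ξ)) * 𝓕 (H n) ξ * (starRingEnd ℂ) (𝓕 (H m) ξ) := by
        intro ξ
        rw [Real.rpow_two, Complex.ofReal_pow, ← Complex.mul_conj']
        simp only [V, map_sum, Finset.sum_mul_sum]
        refine Finset.sum_congr rfl fun n _ => Finset.sum_congr rfl fun m _ => ?_
        have h5 : Complex.exp ((((m - n : ℤ) : ℝ) * p ξ : ℝ) * Complex.I) =
            w m ξ * (starRingEnd ℂ) (w n ξ) := by
          simp only [w, ← Complex.exp_conj, ← Complex.exp_add, map_mul, Complex.conj_ofReal,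
            Complex.conj_I]
          congr 1
          push_cast
          ring
        rw [h5]
        simp only [map_mul, Complex.conj_conj]
        ring
      have h6 : ∀ n m : ℤ, Integrable fun ξ =>
          Complex.exp ((((m - n : ℤ) : ℝ) * p ξ : ℝ) * Complex.I) *
          (χ ξ * (starRingEnd ℂ) (χ ξ)) * 𝓕 (H n) ξ * (starRingEnd ℂ) (𝓕 (H m) ξ) := by
        intro n m
        have := hFc n
        have := Complex.continuous_conj.comp (hFc m)
        have hc1 := Complex.continuous_conj.comp hχ
        refine Continuous.integrable_of_hasCompactSupport ?_
          (HasCompactSupport.intro hχc fun ξ hξ => ?_)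
        · exact (((by fun_prop : Continuous fun ξ =>
            Complex.exp ((((m - n : ℤ) : ℝ) * p ξ : ℝ) * Complex.I)).mul (hχ.mul hc1)).mul
            (hFc n)).mul this
        · simp [image_eq_zero_of_notMem_tsupport hξ]
      rw [← integral_complex_ofReal]
      simp only [h4]
      rw [integral_finsetSum _ fun n _ => integrable_finsetSum _ fun m _ => h6 n m]
      exact Finset.sum_congr rfl fun n _ => integral_finsetSum _ fun m _ => h6 n m
    have h7 : ∫ ξ, ‖V ξ‖ ^ (2 : ℝ) = ‖((∫ ξ, ‖V ξ‖ ^ (2 : ℝ) : ℝ) : ℂ)‖ := by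
      rw [Complex.norm_real, Real.norm_of_nonneg (integral_nonneg fun ξ => by positivity)]
    rw [h7, h3]
    exact (norm_sum_le _ _).trans (Finset.sum_le_sum fun n _ => norm_sum_le _ _)
  gcongr

lemma summable_one_add_abs_int_rpow {s : ℝ} (hs : 1 < s) :
    Summable fun n : ℤ => (1 + |(n : ℝ)|) ^ (-s) := by
  refine Summable.of_norm_bounded_eventually (Real.summable_abs_int_rpow hs) ?_
  filter_upwards [(Set.finite_singleton (0 : ℤ)).compl_mem_cofinite] with n hn
  have hn0 : n ≠ 0 := by simpa using hn
  have h1 : 0 < |(n : ℝ)| := abs_pos.2 (by exact_mod_cast hn0)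
  rw [Real.norm_of_nonneg (by positivity)]
  exact Real.rpow_le_rpow_of_nonpos h1 (by linarith) (by linarith)

/-- Strichartz estimate along integer times. The truncated norms are dualized with
`|u|^{r-2} u` cut off to a ball, weighted by `‖u n‖_r ^ (q - r)`. -/
theorem exists_sum_freqEvol_le (hp : Continuous p) (hχ : Continuous χ)
    (hχc : HasCompactSupport χ) {σ q r : ℝ} (hq : 2 < q) (hr : 2 < r)
    (hσ : 1 < σ * (1 - 2 / r) * (q / 2))
    (hdecay : ∃ C : ℝ, ∀ (n : ℤ) (x : E),
      ‖𝓕⁻ (fun ξ => Complex.exp (((n : ℝ) * p ξ : ℝ) * Complex.I) *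
        (χ ξ * (starRingEnd ℂ) (χ ξ))) x‖ ≤ C * (1 + |(n : ℝ)|) ^ (-σ)) :
    ∃ C : ℝ, 0 ≤ C ∧ ∀ φ : E → ℂ, MemLp φ 2 → ∀ (S : Finset ℤ) (R : ℝ),
      (∑ n ∈ S, ((∫ x in Metric.closedBall 0 R, ‖freqEvol p χ φ n x‖ ^ r) ^ (1 / r)) ^ q) ^ (1 / q)
        ≤ C * (∫ ξ, ‖φ ξ‖ ^ (2 : ℝ)) ^ (1 / 2 : ℝ) := by
  obtain ⟨D₀, hD₀⟩ := hdecay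
  set D := max D₀ 1 with hD
  have hDpos : 0 < D := lt_of_lt_of_le one_pos (le_max_right _ _)
  obtain ⟨Kχ, hKχ⟩ := hχc.exists_bound_of_continuous hχ
  have hr0 : 0 < r := by linarith
  have hq0 : 0 < q := by linarith
  have hr1 : 0 < r - 1 := by linarith
  have hq1 : 0 < q - 1 := by linarith
  have hr2 : 0 < 1 - 2 / r := by rw [sub_pos, div_lt_one hr0]; exact hr
  obtain ⟨c, hc0, hc⟩ := norm_integral_mul_fourier_conj_fourier_le (E := E) hr (sq_nonneg Kχ)
  let k : ℤ → ℝ := fun n => (1 + |(n : ℝ)|) ^ (-(σ * (1 - 2 / r)))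
  have hk0 : ∀ n, 0 < k n := fun n => by positivity
  have hk : Summable fun n => k n ^ (q / 2) := by
    have := summable_one_add_abs_int_rpow hσ
    refine this.congr fun n => ?_
    simp only [k]
    rw [← Real.rpow_mul (by positivity)]
    congr 1
    ring
  have hkn : ∀ n, k (-n) = k n := fun n => by simp [k]
  set κ := ∑' n, k n ^ (q / 2)
  have hκ0 : 0 ≤ κ := tsum_nonneg fun n => (Real.rpow_pos_of_pos (hk0 n) _).le
  set C := (c * D ^ (1 - 2 / r) * κ ^ (2 / q)) ^ (1 / 2 : ℝ) with hC
  have hC0 : 0 ≤ C := by positivity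
  refine ⟨C, hC0, fun φ hφ S R => ?_⟩
  set u : ℤ → E → ℂ := fun n => freqEvol p χ φ n
  have huc : ∀ n, Continuous (u n) := fun n => continuous_freqEvol hp hχ hχc hφ n
  set Bl := Metric.closedBall (0 : E) R
  have hBlm : MeasurableSet Bl := Metric.isClosed_closedBall.measurableSet
  have hcB : ∀ f : E → ℂ, Continuous f → Integrable (Bl.indicator f) := fun f hf =>
    (hf.continuousOn.integrableOn_compact (isCompact_closedBall _ _)).integrable_indicator hBlm
  have hpB : ∀ (f : E → ℂ) (s : ℝ≥0∞), Continuous f → MemLp (Bl.indicator f) s := fun f s hf => by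
    have hfin : IsFiniteMeasure ((volume : Measure E).restrict Bl) :=
      ⟨by rw [Measure.restrict_apply_univ]; exact measure_closedBall_lt_top⟩
    obtain ⟨K, hK⟩ := (isCompact_closedBall (0 : E) R).exists_bound_of_continuousOn hf.continuousOn
    rw [memLp_indicator_iff_restrict hBlm]
    refine MemLp.of_bound hf.aestronglyMeasurable K ?_
    filter_upwards [ae_restrict_mem hBlm] with x hx using hK x hx
  let I : ℤ → ℝ := fun n => ∫ x in Bl, ‖u n x‖ ^ r
  have hI0 : ∀ n, 0 ≤ I n := fun n => integral_nonneg fun x => by positivity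
  let a : ℤ → ℝ := fun n => (I n) ^ (1 / r)
  have ha0 : ∀ n, 0 ≤ a n := fun n => Real.rpow_nonneg (hI0 n) _
  have haI : ∀ n, a n ^ r = I n := fun n => by
    simp only [a]
    rw [← Real.rpow_mul (hI0 n), one_div, inv_mul_cancel₀ hr0.ne', Real.rpow_one]
  let G : ℤ → E → ℂ := fun n x => ((a n ^ (q - r) * ‖u n x‖ ^ (r - 2) : ℝ) : ℂ) * u n x
  have hGc : ∀ n, Continuous (G n) := fun n => by
    have := huc n
    exact (Complex.continuous_ofReal.comp (continuous_const.mul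
      ((huc n).norm.rpow_const fun _ => Or.inr (by linarith)))).mul (huc n)
  let H : ℤ → E → ℂ := fun n => Bl.indicator (G n)
  have hGn : ∀ n x, ‖G n x‖ = a n ^ (q - r) * ‖u n x‖ ^ (r - 1) := by
    intro n x
    simp only [G]
    rw [norm_mul, Complex.norm_real, Real.norm_of_nonneg
      (mul_nonneg (Real.rpow_nonneg (ha0 n) _) (by positivity)), mul_assoc]
    congr 1
    conv_lhs => rw [← Real.rpow_one ‖u n x‖, ← Real.rpow_mul (norm_nonneg _), one_mul]
    rw [← Real.rpow_add_of_nonneg (norm_nonneg _) (by linarith) zero_le_one]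
    congr 1
    ring
  -- unlike `Real.rpow_add_of_nonneg`, this allows a negative exponent `s`
  have hpow : ∀ {v : ℝ} (s t z : ℝ), 0 ≤ v → z ≠ 0 → s + t = z → t ≠ 0 →
      v ^ s * v ^ t = v ^ z := by
    intro v s t z hv hz hst ht
    rcases hv.eq_or_lt with rfl | hv
    · rw [Real.zero_rpow ht, Real.zero_rpow hz, mul_zero]
    · rw [← Real.rpow_add hv, hst]
  have hHint : ∀ n, ∫ x, u n x * (starRingEnd ℂ) (H n x) = ((a n ^ q : ℝ) : ℂ) := by
    intro n
    have h1 : ∀ x, u n x * (starRingEnd ℂ) (H n x) =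
        Bl.indicator (fun x => ((a n ^ (q - r) * ‖u n x‖ ^ r : ℝ) : ℂ)) x := by
      intro x
      by_cases hx : x ∈ Bl
      · simp only [H, Set.indicator_of_mem hx, G, map_mul, Complex.conj_ofReal]
        rw [mul_left_comm, Complex.mul_conj', ← Complex.ofReal_pow, ← Complex.ofReal_mul,
          mul_assoc, ← Real.rpow_natCast ‖u n x‖ 2,
          hpow (r - 2) _ r (norm_nonneg _) hr0.ne' (by push_cast; ring) (by norm_num)]
      · simp [H, Set.indicator_of_notMem hx]
    simp only [h1]
    rw [integral_indicator hBlm, integral_complex_ofReal, integral_const_mul]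
    congr 1
    change a n ^ (q - r) * I n = _
    rw [← haI, hpow _ _ q (ha0 n) hq0.ne' (by ring) hr0.ne']
  have hHnorm : ∀ n, (∫ x, ‖H n x‖ ^ (r / (r - 1))) ^ (1 - 1 / r) = a n ^ (q - 1) := by
    intro n
    have h1 : ∀ x, ‖H n x‖ ^ (r / (r - 1)) =
        Bl.indicator (fun x => (a n ^ (q - r)) ^ (r / (r - 1)) * ‖u n x‖ ^ r) x := by
      intro x
      by_cases hx : x ∈ Bl
      · simp only [H, Set.indicator_of_mem hx, hGn]
        rw [Real.mul_rpow (Real.rpow_nonneg (ha0 n) _) (by positivity),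
          ← Real.rpow_mul (norm_nonneg _)]
        congr 2
        field_simp
      · simp only [H, Set.indicator_of_notMem hx, norm_zero]
        exact Real.zero_rpow (by positivity)
    simp only [h1]
    rw [integral_indicator hBlm, integral_const_mul]
    change ((a n ^ (q - r)) ^ (r / (r - 1)) * I n) ^ (1 - 1 / r) = _
    have h2 : r / (r - 1) * (1 - 1 / r) = 1 := by field_simp
    have h3 : 0 < 1 - 1 / r := by rw [sub_pos, div_lt_one hr0]; linarith
    rw [Real.mul_rpow (Real.rpow_nonneg (Real.rpow_nonneg (ha0 n) _) _) (hI0 n),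
      ← Real.rpow_mul (Real.rpow_nonneg (ha0 n) _), h2, Real.rpow_one, ← haI,
      ← Real.rpow_mul (ha0 n)]
    exact hpow _ _ _ (ha0 n) hq1.ne' (by field_simp; ring) (by positivity)
  have hH1 : ∀ n, Integrable (H n) := fun n => hcB _ (hGc n)
  have hHp : ∀ n (s : ℝ≥0∞), MemLp (H n) s := fun n s => hpB _ s (hGc n)
  have htt := norm_sum_integral_freqEvol_le hp hχ hχc hφ S hH1
  set P := (∫ ξ, ‖φ ξ‖ ^ (2 : ℝ)) ^ (1 / 2 : ℝ)
  have hP0 : 0 ≤ P := Real.rpow_nonneg (integral_nonneg fun ξ => by positivity) _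
  set X := ∑ n ∈ S, a n ^ q with hX
  have hX0 : 0 ≤ X := Finset.sum_nonneg fun n _ => Real.rpow_nonneg (ha0 n) _
  have hlhs : ‖∑ n ∈ S, ∫ x, freqEvol p χ φ n x * (starRingEnd ℂ) (H n x)‖ = X := by
    have : ∑ n ∈ S, ∫ x, freqEvol p χ φ n x * (starRingEnd ℂ) (H n x) = ((X : ℝ) : ℂ) := by
      rw [hX, Complex.ofReal_sum]
      exact Finset.sum_congr rfl fun n _ => hHint n
    rw [this, Complex.norm_real, Real.norm_of_nonneg hX0]
  rw [hlhs] at htt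
  have hχχ : Continuous fun ξ => χ ξ * (starRingEnd ℂ) (χ ξ) :=
    hχ.mul (Complex.continuous_conj.comp hχ)
  have hχχi : Integrable fun ξ => χ ξ * (starRingEnd ℂ) (χ ξ) :=
    hχχ.integrable_of_hasCompactSupport hχc.mul_right
  have hpair : ∀ n m : ℤ, ‖∫ ξ, Complex.exp ((((m - n : ℤ) : ℝ) * p ξ : ℝ) * Complex.I) *
        (χ ξ * (starRingEnd ℂ) (χ ξ)) * 𝓕 (H n) ξ * (starRingEnd ℂ) (𝓕 (H m) ξ)‖ ≤
        c * D ^ (1 - 2 / r) * (k (n - m) * (a n ^ (q - 1) * a m ^ (q - 1))) := by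
    intro n m
    have hpos : 0 < 1 + |((m - n : ℤ) : ℝ)| := by positivity
    have h1 := hc (fun ξ => Complex.exp ((((m - n : ℤ) : ℝ) * p ξ : ℝ) * Complex.I) *
        (χ ξ * (starRingEnd ℂ) (χ ξ))) (D * (1 + |((m - n : ℤ) : ℝ)|) ^ (-σ))
      (integrable_exp_mul hp hχχi _) (fun ξ => by
        rw [norm_mul, Complex.norm_exp_ofReal_mul_I, one_mul, norm_mul, RCLike.norm_conj, ← sq]
        exact pow_le_pow_left₀ (norm_nonneg _) (hKχ ξ) 2) (by positivity)
      (fun x => (hD₀ (m - n) x).trans (by gcongr; exact le_max_left _ _))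
      (H n) (H m) ((hGc n).measurable.indicator hBlm) (hH1 n) (hHp n 2) (hH1 m)
      (hHp m 2) (hHp n _) (hHp m _)
    rw [hHnorm, hHnorm, Real.mul_rpow hDpos.le (by positivity), ← Real.rpow_mul hpos.le] at h1
    refine h1.trans (le_of_eq ?_)
    have : k (n - m) = (1 + |((m - n : ℤ) : ℝ)|) ^ (-σ * (1 - 2 / r)) := by
      rw [← hkn, neg_sub]
      simp only [k]
      rw [neg_mul]
    rw [this]
    ring
  have hsum : ∑ n ∈ S, ∑ m ∈ S,
      ‖∫ ξ, Complex.exp ((((m - n : ℤ) : ℝ) * p ξ : ℝ) * Complex.I) *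
        (χ ξ * (starRingEnd ℂ) (χ ξ)) * 𝓕 (H n) ξ * (starRingEnd ℂ) (𝓕 (H m) ξ)‖ ≤
      c * D ^ (1 - 2 / r) * κ ^ (2 / q) * X ^ (2 - 2 / q) := by
    calc _ ≤ ∑ n ∈ S, ∑ m ∈ S,
          c * D ^ (1 - 2 / r) * (k (n - m) * (a n ^ (q - 1) * a m ^ (q - 1))) :=
          Finset.sum_le_sum fun n _ => Finset.sum_le_sum fun m _ => hpair n m
      _ = c * D ^ (1 - 2 / r) *
          ∑ n ∈ S, ∑ m ∈ S, k (n - m) * (a n ^ (q - 1) * a m ^ (q - 1)) := by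
          simp only [Finset.mul_sum]
      _ ≤ c * D ^ (1 - 2 / r) * (κ ^ (2 / q) * X ^ (2 - 2 / q)) := by
          gcongr
          have h1 := sum_sum_mul_le_of_summable hq hk0 hk S (a := fun n => a n ^ (q - 1))
            fun n => Real.rpow_nonneg (ha0 n) _
          have h2 : ∀ n, (a n ^ (q - 1)) ^ (q / (q - 1)) = a n ^ q := fun n => by
            rw [← Real.rpow_mul (ha0 n)]
            congr 1
            field_simp
          simp only [h2] at h1
          exact h1
      _ = _ := by ring
  have hmain : X ≤ C * P * X ^ (1 - 1 / q) := by
    calc X ≤ P * (c * D ^ (1 - 2 / r) * κ ^ (2 / q) * X ^ (2 - 2 / q)) ^ (1 / 2 : ℝ) := by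
          refine htt.trans (mul_le_mul_of_nonneg_left ?_ hP0)
          exact Real.rpow_le_rpow (by positivity) hsum (by positivity)
      _ = C * P * X ^ (1 - 1 / q) := by
          rw [Real.mul_rpow (by positivity) (by positivity), ← hC, ← Real.rpow_mul hX0]
          rw [show (2 - 2 / q) * (1 / 2 : ℝ) = 1 - 1 / q by ring]
          ring
  change X ^ (1 / q) ≤ C * P
  rcases hX0.eq_or_lt with hXz | hXpos
  · rw [← hXz, Real.zero_rpow (by positivity)]
    positivity
  · have h1 : X = X ^ (1 / q) * X ^ (1 - 1 / q) := by
      rw [← Real.rpow_add hXpos]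
      simp
    have h2 : 0 < X ^ (1 - 1 / q) := Real.rpow_pos_of_pos hXpos _
    conv_lhs at hmain => rw [h1]
    exact le_of_mul_le_mul_right hmain h2

end DiscreteStrichartz

/-! ### Strichartz estimates at unit frequency -/

section UnitFrequency

lemma eLpNorm_ofReal_eq_lintegral {X F : Type*} [MeasurableSpace X] {μ : Measure X}
    [NormedAddCommGroup F] {r : ℝ} (hr : 0 < r) (f : X → F) :
    eLpNorm f (ENNReal.ofReal r) μ = (∫⁻ x, ‖f x‖ₑ ^ r ∂μ) ^ (1 / r) := by
  rw [eLpNorm_eq_lintegral_rpow_enorm_toReal (by simpa using hr) ENNReal.ofReal_ne_top,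
    ENNReal.toReal_ofReal hr.le]

variable {E : Type*} [NormedAddCommGroup E] [InnerProductSpace ℝ E] [FiniteDimensional ℝ E]
  [MeasurableSpace E] [BorelSpace E] {p : E → ℝ} {χ : E → ℂ}

lemma continuous_uncurry_freqEvol (hp : Continuous p) (hχ : Continuous χ)
    (hχc : HasCompactSupport χ) {φ : E → ℂ} (hφ : MemLp φ 2) :
    Continuous (Function.uncurry (freqEvol p χ φ)) := by
  have hi := integrable_cutoff_mul hχ hχc hφ
  have he : Function.uncurry (freqEvol p χ φ) = fun z : ℝ × E => ∫ ξ,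
      Complex.exp ((2 * Real.pi * inner ℝ ξ z.2 : ℝ) * Complex.I) •
        (Complex.exp ((z.1 * p ξ : ℝ) * Complex.I) * (χ ξ * φ ξ)) := by
    ext z
    exact Real.fourierInv_eq' _ _
  rw [he]
  refine continuous_of_dominated (bound := fun ξ => ‖χ ξ * φ ξ‖) ?_ ?_ hi.norm ?_
  · intro z
    simp only [smul_eq_mul]
    refine AEStronglyMeasurable.mul (Continuous.aestronglyMeasurable (by fun_prop))
      (AEStronglyMeasurable.mul (Continuous.aestronglyMeasurable (by fun_prop)) hi.1)
  · intro z
    refine Filter.Eventually.of_forall fun ξ => ?_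
    rw [norm_smul, norm_mul, Complex.norm_exp_ofReal_mul_I, Complex.norm_exp_ofReal_mul_I, one_mul,
      one_mul]
  · refine Filter.Eventually.of_forall fun ξ => ?_
    simp only [smul_eq_mul]
    fun_prop

lemma measurable_eLpNorm_freqEvol (hp : Continuous p) (hχ : Continuous χ)
    (hχc : HasCompactSupport χ) {φ : E → ℂ} (hφ : MemLp φ 2) {r : ℝ} (hr : 0 < r) :
    Measurable fun t => eLpNorm (freqEvol p χ φ t) (ENNReal.ofReal r) volume := by
  simp only [eLpNorm_ofReal_eq_lintegral hr]
  have h1 := (continuous_uncurry_freqEvol hp hχ hχc hφ).measurable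
  have h2 : Measurable fun z : ℝ × E => ‖freqEvol p χ φ z.1 z.2‖ₑ ^ r := h1.enorm.pow_const r
  have h3 : Measurable fun t => ∫⁻ x, ‖freqEvol p χ φ t x‖ₑ ^ r := h2.lintegral_prod_right'
  exact h3.pow_const _

lemma memLp_exp_mul {φ : E → ℂ} (hp : Continuous p) (hφ : MemLp φ 2) (t : ℝ) :
    MemLp (fun ξ => Complex.exp ((t * p ξ : ℝ) * Complex.I) * φ ξ) 2 := by
  refine hφ.of_le_mul (c := 1) ?_ (Filter.Eventually.of_forall fun ξ => ?_)
  · exact (Continuous.aestronglyMeasurable (by fun_prop)).mul hφ.1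
  · rw [norm_mul, Complex.norm_exp_ofReal_mul_I]

lemma eLpNorm_exp_mul (φ : E → ℂ) (t : ℝ) :
    eLpNorm (fun ξ => Complex.exp ((t * p ξ : ℝ) * Complex.I) * φ ξ) 2 volume =
      eLpNorm φ 2 volume := by
  refine eLpNorm_congr_norm_ae (Filter.Eventually.of_forall fun ξ => ?_)
  rw [norm_mul, Complex.norm_exp_ofReal_mul_I, one_mul]

lemma freqEvol_add (φ : E → ℂ) (s t : ℝ) :
    freqEvol p χ φ (s + t) =
      freqEvol p χ (fun ξ => Complex.exp ((s * p ξ : ℝ) * Complex.I) * φ ξ) t := by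
  unfold freqEvol
  congr 1
  ext ξ
  have h : Complex.exp (((s + t) * p ξ : ℝ) * Complex.I) =
      Complex.exp ((t * p ξ : ℝ) * Complex.I) * Complex.exp ((s * p ξ : ℝ) * Complex.I) := by
    rw [← Complex.exp_add]
    congr 1
    push_cast
    ring
  rw [h]
  ring

/-- Strichartz estimate along integer times, in terms of full norms: the balls and finite sets of
times in `exists_sum_freqEvol_le` are exhausted by monotone convergence. -/
theorem exists_tsum_eLpNorm_freqEvol_le (hp : Continuous p) (hχ : Continuous χ)
    (hχc : HasCompactSupport χ) {σ q r : ℝ} (hq : 2 < q) (hr : 2 < r)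
    (hσ : 1 < σ * (1 - 2 / r) * (q / 2))
    (hdecay : ∃ C : ℝ, ∀ (n : ℤ) (x : E),
      ‖𝓕⁻ (fun ξ => Complex.exp (((n : ℝ) * p ξ : ℝ) * Complex.I) *
        (χ ξ * (starRingEnd ℂ) (χ ξ))) x‖ ≤ C * (1 + |(n : ℝ)|) ^ (-σ)) :
    ∃ C : ℝ, 0 ≤ C ∧ ∀ φ : E → ℂ, MemLp φ 2 →
      ∑' n : ℤ, eLpNorm (freqEvol p χ φ n) (ENNReal.ofReal r) volume ^ q ≤
        (ENNReal.ofReal C * eLpNorm φ 2 volume) ^ q := by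
  obtain ⟨C, hC0, hC⟩ := exists_sum_freqEvol_le hp hχ hχc hq hr hσ hdecay
  have hr0 : 0 < r := by linarith
  have hq0 : 0 < q := by linarith
  refine ⟨C, hC0, fun φ hφ => ?_⟩
  have huc : ∀ n : ℤ, Continuous (freqEvol p χ φ n) := fun n =>
    continuous_freqEvol hp hχ hχc hφ n
  have hφ2 : ENNReal.ofReal ((∫ ξ, ‖φ ξ‖ ^ (2 : ℝ)) ^ (1 / 2 : ℝ)) = eLpNorm φ 2 volume := by
    have h1 : Integrable fun ξ => ‖φ ξ‖ ^ (2 : ℝ) := by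
      simpa using hφ.integrable_norm_rpow (by norm_num) (by norm_num)
    rw [← ENNReal.ofReal_rpow_of_nonneg (integral_nonneg fun ξ => by positivity) (by norm_num),
      ofReal_integral_eq_lintegral_ofReal h1 (Filter.Eventually.of_forall fun ξ => by positivity),
      eLpNorm_eq_lintegral_rpow_enorm_toReal (by norm_num) (by norm_num)]
    simp only [ENNReal.toReal_ofNat]
    congr 2
    ext ξ
    rw [← ENNReal.ofReal_rpow_of_nonneg (norm_nonneg _) (by norm_num), ofReal_norm]
  have hball : ∀ (n : ℤ) (R : ℝ),
      (∫⁻ x in Metric.closedBall 0 R, ‖freqEvol p χ φ n x‖ₑ ^ r) ^ (1 / r) =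
      ENNReal.ofReal ((∫ x in Metric.closedBall 0 R, ‖freqEvol p χ φ n x‖ ^ r) ^ (1 / r)) := by
    intro n R
    have hc : Continuous fun x => ‖freqEvol p χ φ n x‖ ^ r :=
      (huc n).norm.rpow_const fun _ => Or.inr hr0.le
    rw [← ENNReal.ofReal_rpow_of_nonneg (integral_nonneg fun ξ => by positivity) (by positivity),
      ofReal_integral_eq_lintegral_ofReal
        (hc.continuousOn.integrableOn_compact (isCompact_closedBall _ _))
        (Filter.Eventually.of_forall fun ξ => by positivity)]
    congr 2
    ext ξ
    rw [← ENNReal.ofReal_rpow_of_nonneg (norm_nonneg _) hr0.le, ofReal_norm]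
  rw [ENNReal.tsum_eq_iSup_sum]
  refine iSup_le fun S => ?_
  have hlim : Filter.Tendsto (fun j : ℕ => ∑ n ∈ S,
      ((∫⁻ x in Metric.closedBall 0 (j : ℝ), ‖freqEvol p χ φ n x‖ₑ ^ r) ^ (1 / r)) ^ q)
      Filter.atTop (nhds (∑ n ∈ S, eLpNorm (freqEvol p χ φ n) (ENNReal.ofReal r) volume ^ q)) := by
    refine tendsto_finsetSum _ fun n _ => ?_
    rw [eLpNorm_ofReal_eq_lintegral hr0]
    have hcover := aecover_closedBall (μ := (volume : Measure E)) (x := 0)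
      tendsto_natCast_atTop_atTop
    exact ((hcover.lintegral_tendsto_of_countably_generated
      ((huc n).measurable.enorm.pow_const r).aemeasurable).ennrpow_const _).ennrpow_const _
  refine le_of_tendsto' hlim fun j => ?_
  simp only [hball]
  rw [← hφ2, ← ENNReal.ofReal_mul hC0]
  have h1 := hC φ hφ S j
  have h2 : ∀ n ∈ S, 0 ≤ ((∫ x in Metric.closedBall 0 (j : ℝ),
      ‖freqEvol p χ φ n x‖ ^ r) ^ (1 / r)) ^ q := fun n _ =>
    Real.rpow_nonneg (Real.rpow_nonneg (integral_nonneg fun x => by positivity) _) _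
  have h3 := Real.rpow_le_rpow (Real.rpow_nonneg (Finset.sum_nonneg h2) _) h1 hq0.le
  rw [← Real.rpow_mul (Finset.sum_nonneg h2), one_div_mul_cancel hq0.ne', Real.rpow_one] at h3
  calc ∑ n ∈ S, ENNReal.ofReal ((∫ x in Metric.closedBall 0 (j : ℝ),
        ‖freqEvol p χ φ n x‖ ^ r) ^ (1 / r)) ^ q
      = ENNReal.ofReal (∑ n ∈ S, ((∫ x in Metric.closedBall 0 (j : ℝ),
        ‖freqEvol p χ φ n x‖ ^ r) ^ (1 / r)) ^ q) := by
        rw [ENNReal.ofReal_sum_of_nonneg h2]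
        refine Finset.sum_congr rfl fun n _ => ?_
        rw [ENNReal.ofReal_rpow_of_nonneg
          (Real.rpow_nonneg (integral_nonneg fun x => by positivity) _) hq0.le]
    _ ≤ _ := by
        rw [ENNReal.ofReal_rpow_of_nonneg (mul_nonneg hC0 (Real.rpow_nonneg
          (integral_nonneg fun ξ => by positivity) _)) hq0.le]
        exact ENNReal.ofReal_le_ofReal h3

lemma lintegral_eq_lintegral_tsum_add_int {f : ℝ → ℝ≥0∞} (hf : Measurable f) :
    ∫⁻ t, f t = ∫⁻ s in Set.Ioc (0 : ℝ) 1, ∑' n : ℤ, f (s + n) := by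
  have h1 : ∫⁻ t, f t = ∑' n : ℤ, ∫⁻ t in Set.Ioc (n : ℝ) (n + 1), f t := by
    rw [← lintegral_iUnion (fun _ => measurableSet_Ioc) (Set.pairwise_disjoint_Ioc_intCast ℝ),
      iUnion_Ioc_intCast, Measure.restrict_univ]
  have h2 : ∀ n : ℤ, Measurable fun s => f (s + n) := fun n => hf.comp (measurable_add_const _)
  rw [h1, lintegral_tsum fun n => (h2 n).aemeasurable]
  refine tsum_congr fun n => ?_
  rw [← lintegral_indicator measurableSet_Ioc, ← lintegral_indicator measurableSet_Ioc,
    ← lintegral_add_right_eq_self _ (n : ℝ)]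
  congr 1
  ext s
  simp only [Set.indicator_apply, Set.mem_Ioc]
  congr 1
  apply propext
  constructor <;> rintro ⟨ha, hb⟩ <;> constructor <;> linarith

/-- Strichartz estimate at unit frequency. The integral over `ℝ` is an average, over shifts in
`(0, 1]`, of sums along integer times. -/
theorem exists_eLpNorm_eLpNorm_freqEvol_le (hp : Continuous p) (hχ : Continuous χ)
    (hχc : HasCompactSupport χ) {σ r : ℝ} {q : ℝ≥0∞} (hq : 2 < q) (hr : 2 < r) (hσ0 : 0 < σ)
    (hσ : 2 * (q⁻¹).toReal < σ * (1 - 2 / r))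
    (hdecay : ∃ C : ℝ, ∀ (n : ℤ) (x : E),
      ‖𝓕⁻ (fun ξ => Complex.exp (((n : ℝ) * p ξ : ℝ) * Complex.I) *
        (χ ξ * (starRingEnd ℂ) (χ ξ))) x‖ ≤ C * (1 + |(n : ℝ)|) ^ (-σ)) :
    ∃ C : ℝ, 0 ≤ C ∧ ∀ φ : E → ℂ, MemLp φ 2 →
      eLpNorm (fun t => eLpNorm (freqEvol p χ φ t) (ENNReal.ofReal r) volume) q volume ≤
        ENNReal.ofReal C * eLpNorm φ 2 volume := by
  have hr0 : 0 < r := by linarith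
  have hr2 : 0 < 1 - 2 / r := by rw [sub_pos, div_lt_one hr0]; exact hr
  rcases eq_or_ne q ⊤ with rfl | hqtop
  · -- any large finite exponent along integer times controls the single time `0`
    set s := σ * (1 - 2 / r) with hs
    have hs0 : 0 < s := by positivity
    have hq' : 1 < s * ((4 / s + 4) / 2) := by
      have : s * ((4 / s + 4) / 2) = 2 + 2 * s := by field_simp; norm_num
      rw [this]; linarith
    have h4 : 0 < 4 / s := by positivity
    obtain ⟨C, hC0, hC⟩ := exists_tsum_eLpNorm_freqEvol_le hp hχ hχc
      (by linarith : 2 < 4 / s + 4) hr hq' hdecay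
    refine ⟨C, hC0, fun φ hφ => ?_⟩
    rw [eLpNorm_exponent_top]
    refine eLpNormEssSup_le_of_ae_enorm_bound (Filter.Eventually.of_forall fun t => ?_)
    rw [enorm_eq_self]
    have h1 := (ENNReal.le_tsum (0 : ℤ)).trans (hC _ (memLp_exp_mul hp hφ t))
    rw [ENNReal.rpow_le_rpow_iff (by linarith), ← freqEvol_add, eLpNorm_exp_mul] at h1
    simpa using h1
  · set Q := q.toReal with hQ
    have hQ2 : 2 < Q := by
      rw [hQ, ← ENNReal.toReal_ofNat 2]
      exact (ENNReal.toReal_lt_toReal (by norm_num) hqtop).2 hq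
    have hQ0 : 0 < Q := by linarith
    have hQσ : 1 < σ * (1 - 2 / r) * (Q / 2) := by
      rw [ENNReal.toReal_inv, ← hQ, ← div_eq_mul_inv, div_lt_iff₀ hQ0] at hσ
      linarith
    obtain ⟨C, hC0, hC⟩ := exists_tsum_eLpNorm_freqEvol_le hp hχ hχc hQ2 hr hQσ hdecay
    refine ⟨C, hC0, fun φ hφ => ?_⟩
    rw [eLpNorm_eq_lintegral_rpow_enorm_toReal (by rintro rfl; simp at hq) hqtop, ← hQ]
    simp only [enorm_eq_self]
    have hm := (measurable_eLpNorm_freqEvol hp hχ hχc hφ hr0).pow_const Q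
    rw [lintegral_eq_lintegral_tsum_add_int hm]
    have h1 : ∀ s : ℝ, ∑' n : ℤ,
        eLpNorm (freqEvol p χ φ (s + n)) (ENNReal.ofReal r) volume ^ Q ≤
          (ENNReal.ofReal C * eLpNorm φ 2 volume) ^ Q := by
      intro s
      have := hC _ (memLp_exp_mul hp hφ s)
      rw [eLpNorm_exp_mul] at this
      simpa only [freqEvol_add] using this
    have h2 : ∫⁻ s in Set.Ioc (0 : ℝ) 1, ∑' n : ℤ,
        eLpNorm (freqEvol p χ φ (s + n)) (ENNReal.ofReal r) volume ^ Q ≤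
          (ENNReal.ofReal C * eLpNorm φ 2 volume) ^ Q := by
      refine (lintegral_mono h1).trans ?_
      simp
    calc _ ≤ ((ENNReal.ofReal C * eLpNorm φ 2 volume) ^ Q) ^ (1 / Q) := by gcongr
      _ = _ := by rw [← ENNReal.rpow_mul, mul_one_div_cancel hQ0.ne', ENNReal.rpow_one]

end UnitFrequency

/-! ### Hölder's inequality and scaling -/

section Scaling

lemma eLpNorm_const_mul_le {X : Type*} [MeasurableSpace X] {μ : Measure X} (c : ℝ)
    (f : X → ℝ≥0∞) (q : ℝ≥0∞) :
    eLpNorm (fun t => ENNReal.ofReal c * f t) q μ ≤ ENNReal.ofReal c * eLpNorm f q μ :=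
  eLpNorm_le_nnreal_smul_eLpNorm_of_ae_le_mul' (c := c.toNNReal)
    (Filter.Eventually.of_forall fun _ => le_rfl) q

/-- The Cauchy-Schwarz inequality `‖f g‖_{q/2} ≤ ‖f‖_q ‖g‖_q` for `[0, ∞]`-valued functions. -/
lemma eLpNorm_mul_le_half {X : Type*} [MeasurableSpace X] {μ : Measure X} {f g : X → ℝ≥0∞}
    (hf : Measurable f) (hg : Measurable g) {q : ℝ≥0∞} (hq : 2 < q) :
    eLpNorm (fun t => f t * g t) (q / 2) μ ≤ eLpNorm f q μ * eLpNorm g q μ := by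
  rcases eq_or_ne q ⊤ with rfl | hqtop
  · rw [ENNReal.top_div_of_ne_top (by norm_num), eLpNorm_exponent_top, eLpNorm_exponent_top,
      eLpNorm_exponent_top]
    simp only [eLpNormEssSup, enorm_eq_self]
    exact ENNReal.essSup_mul_le f g
  · have hq0 : q ≠ 0 := by rintro rfl; simp at hq
    have hQ0 : 0 < q.toReal := ENNReal.toReal_pos hq0 hqtop
    have h2 : (q / 2).toReal = q.toReal / 2 := by rw [ENNReal.toReal_div]; simp
    rw [eLpNorm_eq_lintegral_rpow_enorm_toReal (by simpa using hq0)
        (ENNReal.div_ne_top hqtop (by norm_num)),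
      eLpNorm_eq_lintegral_rpow_enorm_toReal hq0 hqtop,
      eLpNorm_eq_lintegral_rpow_enorm_toReal hq0 hqtop, h2]
    simp only [enorm_eq_self]
    set Q := q.toReal
    have hcs := ENNReal.lintegral_mul_le_Lp_mul_Lq μ Real.HolderConjugate.two_two
      (hf.pow_const (Q / 2)).aemeasurable (hg.pow_const (Q / 2)).aemeasurable
    have h3 : ∀ v : ℝ≥0∞, (v ^ (Q / 2)) ^ (2 : ℝ) = v ^ Q := fun v => by
      rw [← ENNReal.rpow_mul]; congr 1; ring
    simp only [Pi.mul_apply, h3, ← ENNReal.mul_rpow_of_nonneg _ _ (by positivity : 0 ≤ Q / 2)]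
      at hcs
    refine (ENNReal.rpow_le_rpow hcs (by positivity : 0 ≤ 1 / (Q / 2))).trans (le_of_eq ?_)
    rw [ENNReal.mul_rpow_of_nonneg _ _ (by positivity), ← ENNReal.rpow_mul, ← ENNReal.rpow_mul]
    congr 2 <;> field_simp

lemma eLpNorm_mul_le_of_holderTriple {X : Type*} [MeasurableSpace X] {μ : Measure X} {u v : X → ℂ}
    (hu : AEStronglyMeasurable u μ) (hv : AEStronglyMeasurable v μ) {p q r : ℝ≥0∞}
    (h : ENNReal.HolderTriple p q r) :
    eLpNorm (fun x => u x * v x) r μ ≤ eLpNorm u p μ * eLpNorm v q μ := by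
  have h1 := eLpNorm_le_eLpNorm_mul_eLpNorm'_of_norm (p := p) (q := q) (r := r) hu hv
    (fun a b => a * b) 1 (Filter.Eventually.of_forall fun x => by simp) (hpqr := h)
  simpa using h1

variable {E : Type*} [NormedAddCommGroup E] [InnerProductSpace ℝ E] [FiniteDimensional ℝ E]
  [MeasurableSpace E] [BorelSpace E]

lemma eLpNorm_comp_smul {F : Type*} [TopologicalSpace F] [ContinuousENorm F] {R : ℝ} (hR : 0 < R)
    (g : E → F) (q : ℝ≥0∞) :
    eLpNorm (fun x => g (R • x)) q volume =
      ENNReal.ofReal (R ^ (-(Module.finrank ℝ E * (q⁻¹).toReal))) * eLpNorm g q volume := by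
  have hemb : MeasurableEmbedding fun x : E => R • x :=
    (Homeomorph.smulOfNeZero R hR.ne').measurableEmbedding
  have h1 := hemb.eLpNorm_map_measure (μ := volume) (g := g) (p := q)
  rw [Measure.map_addHaar_smul _ hR.ne', eLpNorm_smul_measure_of_ne_zero (by
    rw [Ne, ENNReal.ofReal_eq_zero, not_le]; positivity)] at h1
  rw [show (fun x => g (R • x)) = g ∘ fun x => R • x from rfl, ← h1, smul_eq_mul,
    abs_of_pos (by positivity), ENNReal.ofReal_rpow_of_pos (by positivity), one_div]
  congr 2
  rw [← Real.rpow_natCast, ← Real.rpow_neg hR.le, ← Real.rpow_mul hR.le]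
  congr 1
  ring

lemma memLp_comp_smul {R : ℝ} (hR : 0 < R) {g : E → ℂ} {q : ℝ≥0∞} (hg : MemLp g q) :
    MemLp (fun x => g (R • x)) q := by
  have hq : Measure.QuasiMeasurePreserving (fun x : E => R • x) :=
    ⟨measurable_const_smul R, by
      rw [Measure.map_addHaar_smul _ hR.ne']
      exact Measure.smul_absolutelyContinuous⟩
  refine ⟨hg.1.comp_quasiMeasurePreserving hq, ?_⟩
  rw [eLpNorm_comp_smul hR]
  exact ENNReal.mul_lt_top ENNReal.ofReal_lt_top hg.2

lemma fourierInv_comp_inv_smul {R : ℝ} (hR : 0 < R) (g : E → ℂ) (x : E) :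
    𝓕⁻ (fun ξ => g (R⁻¹ • ξ)) x = ((R ^ Module.finrank ℝ E : ℝ) : ℂ) * 𝓕⁻ g (R • x) := by
  rw [Real.fourierInv_eq', Real.fourierInv_eq']
  have h1 := Measure.integral_comp_inv_smul (volume : Measure E)
    (fun η => Complex.exp ((2 * Real.pi * inner ℝ η (R • x) : ℝ) * Complex.I) • g η) R
  rw [abs_of_pos (by positivity), Complex.real_smul] at h1
  rw [← h1]
  congr 1
  ext ξ
  rw [real_inner_smul_left, real_inner_smul_right, inv_mul_cancel_left₀ hR.ne']

end Scaling

/-! ### Linear Strichartz estimates at a dyadic frequency -/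

section LinearStrichartz

lemma contDiff_cutoff_norm {E : Type*} [NormedAddCommGroup E] [InnerProductSpace ℝ E] {ρ : ℝ → ℝ}
    (hρ : IsDyadicCutoff ρ) : ContDiff ℝ ∞ fun ξ : E => (ρ ‖ξ‖ : ℂ) := by
  refine Complex.ofRealCLM.contDiff.comp (f := fun ξ : E => ρ ‖ξ‖) ?_
  rw [contDiff_iff_contDiffAt]
  intro ξ
  by_cases h : ξ = 0
  · have hz : (fun ξ : E => ρ ‖ξ‖) =ᶠ[nhds ξ] fun _ => 0 := by
      have : {ξ : E | ‖ξ‖ < 1 / 2} ∈ nhds ξ :=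
        (isOpen_lt continuous_norm continuous_const).mem_nhds (by simp [h])
      filter_upwards [this] with η hη
      by_contra hne
      have := (hρ.support_subset hne).1
      exact absurd hη (not_lt.2 this)
    exact contDiffAt_const.congr_of_eventuallyEq hz
  · exact hρ.smooth.contDiffAt.comp ξ (contDiffAt_norm ℝ h)

variable {d : ℕ} {ρ : ℝ → ℝ}

lemma IsDyadicCutoff.mem_annulus {E : Type*} [NormedAddCommGroup E] (hρ : IsDyadicCutoff ρ) {ξ : E}
    (h : (ρ ‖ξ‖ : ℂ) ≠ 0) : 1 / 2 ≤ ‖ξ‖ ∧ ‖ξ‖ ≤ 4 :=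
  hρ.support_subset (by simpa using h)

lemma hasCompactSupport_cutoff_norm {E : Type*} [NormedAddCommGroup E] [InnerProductSpace ℝ E]
    [FiniteDimensional ℝ E] (hρ : IsDyadicCutoff ρ) :
    HasCompactSupport fun ξ : E => (ρ ‖ξ‖ : ℂ) := by
  refine HasCompactSupport.intro (isCompact_closedBall (0 : E) 4) fun ξ hξ => ?_
  by_contra h
  exact hξ (by simpa using (hρ.mem_annulus h).2)

/-- The frequency-localized propagator is a rescaling of its unit-frequency model. The factor
`2 π` in the scale comes from the normalization of the Fourier transform. -/
lemma propagator_dyadicProj_ae_eq (hρ : IsDyadicCutoff ρ) {α : ℝ} (hα : 0 ≤ α) (N : ℤ) (t : ℝ)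
    (f : L2Space d) {R : ℝ} (hR : R = 2 ^ N / (2 * Real.pi)) :
    (propagator α t (dyadicProj hρ N f) : EuclideanSpace ℝ (Fin d) → ℂ) =ᵐ[volume]
      fun x => ((R ^ d : ℝ) : ℂ) *
        freqEvol (fun ξ => ‖ξ‖ ^ α) (fun ξ => (ρ ‖ξ‖ : ℂ)) (fun ξ => (𝓕 f : L2Space d) (R • ξ))
          (((2 : ℝ) ^ N) ^ α * t) (R • x) := by
  have h2N : (0 : ℝ) < 2 ^ N := by positivity
  have hR0 : 0 < R := by rw [hR]; positivity
  set E := EuclideanSpace ℝ (Fin d)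
  set φ : E → ℂ := fun ξ => (𝓕 f : L2Space d) ξ
  have hφ2 : MemLp φ 2 := Lp.memLp _
  set Ψ : E → ℂ := fun η => Complex.exp (((((2 : ℝ) ^ N) ^ α * t) * ‖η‖ ^ α : ℝ) * Complex.I) *
    ((ρ ‖η‖ : ℂ) * φ (R • η)) with hΨ
  have hnorm : ∀ ξ : E, ‖(2 * Real.pi) • ξ‖ = 2 ^ N * ‖R⁻¹ • ξ‖ := by
    intro ξ
    rw [norm_smul, norm_smul, norm_inv, Real.norm_of_nonneg hR0.le,
      Real.norm_of_nonneg (by positivity), hR]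
    field_simp
  have hsym : ∀ ξ : E, propagatorSymbol d α t ((2 * Real.pi) • ξ) *
      (dyadicSymbol d ρ N ((2 * Real.pi) • ξ) * φ ξ) = Ψ (R⁻¹ • ξ) := by
    intro ξ
    simp only [propagatorSymbol, dyadicSymbol, Ψ, hnorm, smul_inv_smul₀ hR0.ne',
      mul_div_cancel_left₀ _ h2N.ne']
    congr 4
    rw [Real.mul_rpow h2N.le (norm_nonneg _)]
    ring
  have hpc : Continuous fun ξ : E => ‖ξ‖ ^ α := continuous_norm.rpow_const fun _ => Or.inr hα
  have hΨ1 : Integrable Ψ := integrable_exp_mul hpc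
    (integrable_cutoff_mul (contDiff_cutoff_norm hρ).continuous (hasCompactSupport_cutoff_norm hρ)
      (memLp_comp_smul hR0 hφ2)) _
  have hΨR : Integrable fun ξ => Ψ (R⁻¹ • ξ) := hΨ1.comp_smul (inv_ne_zero hR0.ne')
  have hg : 𝓕 (dyadicProj hρ N f) = (memLp_symbol_mul (dyadicSymbol d ρ N)
      (measurable_dyadicSymbol d hρ N) (bounded_dyadicSymbol d hρ N) (𝓕 f)).toLp _ := by
    rw [dyadicProj, fourierMultiplier, FourierTransform.fourier_fourierInv_eq]
  have hae : (fun ξ => propagatorSymbol d α t ((2 * Real.pi) • ξ) *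
      (𝓕 (dyadicProj hρ N f) : L2Space d) ξ) =ᵐ[volume] fun ξ => Ψ (R⁻¹ • ξ) := by
    rw [hg]
    filter_upwards [(memLp_symbol_mul (dyadicSymbol d ρ N)
      (measurable_dyadicSymbol d hρ N) (bounded_dyadicSymbol d hρ N) (𝓕 f)).coeFn_toLp] with ξ hξ
    rw [hξ, ← hsym]
  rw [propagator, fourierMultiplier]
  have hmem := memLp_symbol_mul (propagatorSymbol d α t) (measurable_propagatorSymbol d α t)
    (bounded_propagatorSymbol d α t) (𝓕 (dyadicProj hρ N f))
  refine (fourierInv_toLp_ae_eq (hΨR.congr hae.symm) hmem).trans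
    (Filter.Eventually.of_forall fun x => ?_)
  rw [Real.fourierInv_congr_ae hae, fourierInv_comp_inv_smul hR0, finrank_euclideanSpace_fin]
  rfl

/-- Linear Strichartz estimate for a single frequency `2 ^ N`, with non-endpoint exponents. -/
theorem exists_eLpNorm_propagator_dyadicProj_le (hd : 2 ≤ d) {α : ℝ} (hα : 2 < α)
    (hρ : IsDyadicCutoff ρ) {q : ℝ≥0∞} {r : ℝ} (hq : 2 < q) (hr : 2 < r)
    (hqr : 2 * (q⁻¹).toReal + d / r < d / 2) :
    ∃ C : ℝ, 0 < C ∧ ∀ (N : ℤ) (f : L2Space d),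
      Measurable (fun t => eLpNorm (propagator α t (dyadicProj hρ N f)) (ENNReal.ofReal r) volume) ∧
      eLpNorm (fun t => eLpNorm (propagator α t (dyadicProj hρ N f)) (ENNReal.ofReal r) volume)
        q volume ≤
        ENNReal.ofReal (C * 2 ^ ((N : ℝ) * (d / 2 - d / r - α * (q⁻¹).toReal)) * ‖f‖) := by
  set E := EuclideanSpace ℝ (Fin d)
  have hr0 : 0 < r := by linarith
  have hd0 : (0 : ℝ) < d := by exact_mod_cast (by omega : 0 < d)
  have hfin : Module.finrank ℝ E = d := finrank_euclideanSpace_fin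
  have hnt : Nontrivial E := Module.nontrivial_of_finrank_pos (R := ℝ) (by rw [hfin]; omega)
  set p : E → ℝ := fun ξ => ‖ξ‖ ^ α
  set χ : E → ℂ := fun ξ => (ρ ‖ξ‖ : ℂ)
  have hp : Continuous p := continuous_norm.rpow_const fun _ => Or.inr (by linarith)
  have hχ : ContDiff ℝ ∞ χ := contDiff_cutoff_norm hρ
  have hχc : HasCompactSupport χ := hasCompactSupport_cutoff_norm hρ
  have hdecay : ∃ C : ℝ, ∀ (n : ℤ) (x : E),
      ‖𝓕⁻ (fun ξ => Complex.exp (((n : ℝ) * p ξ : ℝ) * Complex.I) *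
        (χ ξ * (starRingEnd ℂ) (χ ξ))) x‖ ≤ C * (1 + |(n : ℝ)|) ^ (-((d : ℝ) / 2)) := by
    obtain ⟨C, hC⟩ := exists_norm_fourierInv_propagator_le (E := E) hα
      (χ := fun ξ => χ ξ * (starRingEnd ℂ) (χ ξ))
      (hχ.mul (Complex.conjCLE.contDiff.comp hχ))
      (fun ξ h => hρ.mem_annulus (left_ne_zero_of_mul h))
    rw [hfin] at hC
    exact ⟨C, fun n x => hC n x⟩
  obtain ⟨C, hC0, hC⟩ := exists_eLpNorm_eLpNorm_freqEvol_le hp hχ.continuous hχc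
    (σ := (d : ℝ) / 2) hq hr (by positivity) (by
      have : (d : ℝ) / 2 * (1 - 2 / r) = d / 2 - d / r := by field_simp
      rw [this]
      linarith) hdecay
  set κ := (q⁻¹).toReal
  set A : ℝ := (2 * Real.pi) ^ (-((d : ℝ) / 2 - d / r))
  have hA0 : 0 < A := by positivity
  refine ⟨(C + 1) * A, by positivity, fun N f => ?_⟩
  have h2N : (0 : ℝ) < 2 ^ N := by positivity
  set R : ℝ := 2 ^ N / (2 * Real.pi) with hR
  have hR0 : 0 < R := by positivity
  set l : ℝ := ((2 : ℝ) ^ N) ^ α with hl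
  have hl0 : 0 < l := by positivity
  set φ : E → ℂ := fun ξ => (𝓕 f : L2Space d) (R • ξ) with hφ
  have hφ2 : MemLp φ 2 := memLp_comp_smul hR0 (Lp.memLp (𝓕 f : L2Space d))
  have hφn : eLpNorm φ 2 volume = ENNReal.ofReal (R ^ (-((d : ℝ) / 2))) * ENNReal.ofReal ‖f‖ := by
    rw [hφ, eLpNorm_comp_smul hR0 (fun ξ => (𝓕 f : L2Space d) ξ), hfin, ← Lp.enorm_def,
      ← ofReal_norm, Lp.norm_fourier_eq]
    congr 3
    simp
    ring
  have hx : ∀ t, eLpNorm (propagator α t (dyadicProj hρ N f)) (ENNReal.ofReal r) volume =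
      ENNReal.ofReal (R ^ ((d : ℝ) - d / r)) *
        eLpNorm (freqEvol p χ φ (l * t)) (ENNReal.ofReal r) volume := by
    intro t
    rw [eLpNorm_congr_ae (propagator_dyadicProj_ae_eq hρ (by linarith) N t f hR)]
    have h1 := eLpNorm_const_smul (((R ^ d : ℝ) : ℂ))
      (fun x => freqEvol p χ φ (l * t) (R • x)) (ENNReal.ofReal r) volume
    refine h1.trans ?_
    rw [eLpNorm_comp_smul hR0, hfin, ← ofReal_norm, Complex.norm_real,
      Real.norm_of_nonneg (by positivity), ← mul_assoc, ← ENNReal.ofReal_mul (by positivity),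
      ENNReal.toReal_inv, ENNReal.toReal_ofReal hr0.le, ← Real.rpow_natCast, ← Real.rpow_add hR0]
    congr 3
  have hm := measurable_eLpNorm_freqEvol hp hχ.continuous hχc hφ2 hr0
  simp only [hx]
  refine ⟨(hm.comp (measurable_const_mul l)).const_mul _, ?_⟩
  refine (eLpNorm_const_mul_le _ _ q).trans ?_
  have h2 := eLpNorm_comp_smul hl0
    (fun t : ℝ => eLpNorm (freqEvol p χ φ t) (ENNReal.ofReal r) volume) q
  simp only [smul_eq_mul, Module.finrank_self, Nat.cast_one, one_mul] at h2
  rw [h2]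
  calc ENNReal.ofReal (R ^ ((d : ℝ) - d / r)) * (ENNReal.ofReal (l ^ (-κ)) *
        eLpNorm (fun t => eLpNorm (freqEvol p χ φ t) (ENNReal.ofReal r) volume) q volume)
      ≤ ENNReal.ofReal (R ^ ((d : ℝ) - d / r)) * (ENNReal.ofReal (l ^ (-κ)) *
        (ENNReal.ofReal (C + 1) *
          (ENNReal.ofReal (R ^ (-((d : ℝ) / 2))) * ENNReal.ofReal ‖f‖))) := by
        gcongr
        rw [← hφn]
        refine (hC φ hφ2).trans ?_
        gcongr
        linarith
    _ = ENNReal.ofReal (R ^ ((d : ℝ) - d / r) * (l ^ (-κ) *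
        ((C + 1) * (R ^ (-((d : ℝ) / 2)) * ‖f‖)))) := by
        rw [ENNReal.ofReal_mul (by positivity), ENNReal.ofReal_mul (by positivity),
          ENNReal.ofReal_mul (by positivity), ENNReal.ofReal_mul (by positivity)]
    _ = _ := by
        congr 1
        have h3 : R ^ ((d : ℝ) - d / r) * R ^ (-((d : ℝ) / 2)) =
            2 ^ ((N : ℝ) * (d / 2 - d / r)) * A := by
          rw [← Real.rpow_add hR0, hR, Real.div_rpow h2N.le (by positivity), ← Real.rpow_intCast,
            ← Real.rpow_mul (by norm_num), div_eq_mul_inv, ← Real.rpow_neg (by positivity)]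
          congr 2 <;> ring
        have h4 : l ^ (-κ) = 2 ^ (-((N : ℝ) * (α * κ))) := by
          rw [hl, ← Real.rpow_mul h2N.le, ← Real.rpow_intCast, ← Real.rpow_mul (by norm_num)]
          congr 1
          ring
        have h5 : (2 : ℝ) ^ ((N : ℝ) * (d / 2 - d / r - α * κ)) =
            2 ^ ((N : ℝ) * (d / 2 - d / r)) * 2 ^ (-((N : ℝ) * (α * κ))) := by
          rw [← Real.rpow_add (by norm_num)]
          congr 1
          ring
        rw [h5, h4]
        linear_combination (2 ^ (-((N : ℝ) * (α * κ))) * (C + 1) * ‖f‖) * h3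

end LinearStrichartz

/-! ### The bilinear estimate -/

theorem mainTheorem4 (d : ℕ) (hd : 2 ≤ d) (q r : ℝ≥0∞) (hq : 2 < q) (hr : 2 ≤ r)
    (hr_top : r ≠ ⊤) (hqr : 2 / q + (d : ℝ≥0∞) / r < (d : ℝ≥0∞) / 2) :
    ∃ ε : ℝ, 0 < ε ∧
      ∀ (α : ℝ), 2 < α → ∀ (ρ : ℝ → ℝ) (hρ : IsDyadicCutoff ρ),
        ∃ C : ℝ, 0 < C ∧
          ∀ (M N : ℤ), M ≤ N → ∀ f g : L2Space d,
            mixedNorm (q / 2) (r / 2)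
                (fun t x => propagator α t (dyadicProj hρ N f) x *
                  propagator α t (dyadicProj hρ M g) x)
              ≤ ENNReal.ofReal
                  (C * (2 : ℝ) ^ (((M : ℝ) + (N : ℝ)) * scalingExponent d α q r) *
                    ((2 : ℝ) ^ ((M : ℝ) - (N : ℝ))) ^ ε * ‖f‖ * ‖g‖) := by
  have hd0 : (0 : ℝ) < d := by exact_mod_cast (by omega : 0 < d)
  have hr0 : r ≠ 0 := by rintro rfl; simp at hr
  have hq0 : q ≠ 0 := by rintro rfl; simp at hq
  set s := (r⁻¹).toReal with hs
  set κ := (q⁻¹).toReal with hκ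
  have hs0 : 0 < s := ENNReal.toReal_pos (by simpa using hr_top) (by simpa using hr0)
  have hreal : 2 * κ + d * s < d / 2 := by
    have h1 : 2 / q ≠ ⊤ := ENNReal.div_ne_top (by norm_num) hq0
    have h2 : (d : ℝ≥0∞) / r ≠ ⊤ := ENNReal.div_ne_top (by simp) hr0
    have h3 : (d : ℝ≥0∞) / 2 ≠ ⊤ := ENNReal.div_ne_top (by simp) (by norm_num)
    have h4 := (ENNReal.toReal_lt_toReal (ENNReal.add_ne_top.2 ⟨h1, h2⟩) h3).2 hqr
    rw [ENNReal.toReal_add h1 h2, ENNReal.toReal_div, ENNReal.toReal_div, ENNReal.toReal_div] at h4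
    simpa [hs, hκ, ENNReal.toReal_inv, div_eq_mul_inv] using h4
  have hκ0 : 0 ≤ κ := ENNReal.toReal_nonneg
  -- the high frequency is estimated with `1 / r + δ`, the low one with `1 / r - δ`, in place of
  -- `1 / r`; this yields the factor `2 ^ ((M - N) d δ)`
  obtain ⟨δ, hδ0, hδs, hδ⟩ : ∃ δ : ℝ, 0 < δ ∧ δ < s ∧ 2 * κ + d * (s + δ) < d / 2 := by
    refine ⟨min (s / 2) ((d / 2 - 2 * κ - d * s) / (2 * d)), ?_, ?_, ?_⟩
    · exact lt_min (by positivity) (div_pos (by linarith) (by positivity))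
    · exact (min_le_left _ _).trans_lt (by linarith)
    · have h1 : d * min (s / 2) ((d / 2 - 2 * κ - d * s) / (2 * d)) ≤
          (d / 2 - 2 * κ - d * s) / 2 := by
        calc d * min (s / 2) ((d / 2 - 2 * κ - d * s) / (2 * d))
            ≤ d * ((d / 2 - 2 * κ - d * s) / (2 * d)) := by
              gcongr
              exact min_le_right _ _
          _ = _ := by field_simp
      rw [mul_add]
      linarith
  have hplus : 0 < s + δ := by linarith
  have hminus : 0 < s - δ := by linarith
  have hδ' : 2 * κ + d * (s - δ) < d / 2 := by nlinarith
  -- the exponents `1 / (1 / r ± δ)` exceed `2`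
  have hlt : ∀ v : ℝ, 0 < v → 2 * κ + d * v < d / 2 → 2 < v⁻¹ := by
    intro v hv h
    have : d * v < d * (1 / 2) := by linarith
    have := lt_of_mul_lt_mul_left this hd0.le
    rw [lt_inv_comm₀ (by norm_num) hv]
    linarith
  refine ⟨d * δ, by positivity, fun α hα ρ hρ => ?_⟩
  obtain ⟨C₁, hC₁, h₁⟩ := exists_eLpNorm_propagator_dyadicProj_le hd hα hρ hq
    (hlt _ hplus hδ) (by rwa [div_inv_eq_mul])
  obtain ⟨C₂, hC₂, h₂⟩ := exists_eLpNorm_propagator_dyadicProj_le hd hα hρ hq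
    (hlt _ hminus hδ') (by rwa [div_inv_eq_mul])
  refine ⟨C₁ * C₂, by positivity, fun M N _ f g => ?_⟩
  obtain ⟨hm₁, hb₁⟩ := h₁ N f
  obtain ⟨hm₂, hb₂⟩ := h₂ M g
  have hHolder : ENNReal.HolderTriple (ENNReal.ofReal (s + δ)⁻¹) (ENNReal.ofReal (s - δ)⁻¹)
      (r / 2) := by
    rw [ENNReal.holderTriple_iff, ENNReal.ofReal_inv_of_pos hplus, ENNReal.ofReal_inv_of_pos hminus,
      inv_inv, inv_inv, ← ENNReal.ofReal_add hplus.le hminus.le,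
      ENNReal.inv_div (by norm_num) (by norm_num), show s + δ + (s - δ) = 2 * s by ring,
      ENNReal.ofReal_mul (by norm_num), hs, ENNReal.ofReal_toReal (by simpa using hr0),
      div_eq_mul_inv]
    simp
  calc mixedNorm (q / 2) (r / 2) (fun t x => propagator α t (dyadicProj hρ N f) x *
          propagator α t (dyadicProj hρ M g) x)
      ≤ eLpNorm (fun t =>
          eLpNorm (propagator α t (dyadicProj hρ N f)) (ENNReal.ofReal (s + δ)⁻¹) volume *
          eLpNorm (propagator α t (dyadicProj hρ M g)) (ENNReal.ofReal (s - δ)⁻¹) volume)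
          (q / 2) volume := by
        refine eLpNorm_mono_enorm fun t => ?_
        rw [enorm_eq_self, enorm_eq_self]
        exact eLpNorm_mul_le_of_holderTriple (Lp.aestronglyMeasurable _)
          (Lp.aestronglyMeasurable _) hHolder
    _ ≤ _ := eLpNorm_mul_le_half hm₁ hm₂ hq
    _ ≤ _ := mul_le_mul' hb₁ hb₂
    _ = _ := by
        rw [← ENNReal.ofReal_mul (by positivity)]
        congr 1
        rw [scalingExponent, ← Real.rpow_mul (by norm_num)]
        have h1 : (2 : ℝ) ^ ((N : ℝ) * (d / 2 - d / (s + δ)⁻¹ - α * κ)) *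
            2 ^ ((M : ℝ) * (d / 2 - d / (s - δ)⁻¹ - α * κ)) =
            2 ^ (((M : ℝ) + N) * (d / 2 - d * s - α * κ)) * 2 ^ (((M : ℝ) - N) * (d * δ)) := by
          rw [← Real.rpow_add (by norm_num), ← Real.rpow_add (by norm_num), div_inv_eq_mul,
            div_inv_eq_mul]
          congr 1
          ring
        linear_combination (C₁ * C₂ * ‖f‖ * ‖g‖) * h1
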